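/- Let $\Sigma,\Gamma$ be finite alphabets and let $f:\Sigma^\omega\rightharpoonup\Gamma^\omega$ be a partial function with domain $\mathrm{dom}(f)$. Suppose that $f$ is regular, i.e. realized by a deterministic two-way Muller transducer with look-around: a finite-state device on the tape ${\vdash}a_1a_2\dots$, starting on $\vdash$, whose transitions depend on the current state, the symbol under the head, the state reached by a look-behind DFA on the part of the tape to the left of the head, and a state $p$ of a one-way look-ahead Muller automaton $A$ such that the tape content from the head position on is in $L(A,p)$ (in each configuration at most one such $p$ enables a transition); a transition changes the state, appends a finite word over $\Gamma$ to the output, and moves the head by $\pm1$. The domain of $f$ is the set of words on which the run is infinite, visits arbitrarily large positions, and has its set of infinitely repeated states in the Muller family; on these words the output is infinite and equals $f(w)$. Say that $f$ is computable if there is a deterministic machine $M$ with a read-only one-way input tape, a two-way work tape, and a write-only one-way output tape (the tapes have a left delimiter and are infinite to the right) such that for all $x\in\mathrm{dom}(f)$ and all $i\ge 0$ there is $j\ge 0$ such that the prefix of length $i$ of $f(x)$ is a prefix of $M(x,j)$, where $M(x,j)$ is the output produced by $M$ on $x$ until its input head moves from position $j$ to position $j+1$ (and is the empty word if this move never happens).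 Then $f$ is computable if and only if $f$ is continuous on $\mathrm{dom}(f)$ for the Cantor topologies of $\Sigma^\omega$ and $\Gamma^\omega$. Moreover, the mismatch problem of $f$ is decidable: there is an algorithm that, given $u\in\Sigma^*$ and $v\in\Gamma^*$, decides whether there is $y\in\Sigma^\omega$ such that $uy\in\mathrm{dom}(f)$ and $v$ differs from $f(uy)$ at some position $i\le |v|$. -/

import Mathlib

open Filter

/-! ### Words

An infinite word over `α` is a function `ℕ → α`; `ℕ → α` carries the product of the discrete
topologies, that is, the Cantor topology. A partial function on infinite words is a
`PFun`, written `(ℕ → Sig) →. (ℕ → Gam)`. -/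

/-- The content `⊢ a₁ a₂ …` of an input tape: cell `0` holds the left delimiter (`none`),
cell `i + 1` holds the `i`-th letter (counted from `0`) of the infinite word. -/
def inputTape {α : Type*} (w : ℕ → α) : ℕ → Option α
  | 0 => none
  | i + 1 => some (w i)

/-- The prefix of length `k` of an infinite word. -/
def wordPrefix {α : Type*} (w : ℕ → α) (k : ℕ) : List α :=
  (List.range k).map w

/-- The set of values that a sequence takes infinitely often. -/
def infSet {α : Type*} (ρ : ℕ → α) : Set α :=
  {s | ∃ᶠ n in atTop, ρ n = s}

/-! ### Regular functions: deterministic two-way Muller transducers with look-around -/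

/-- A (nondeterministic) one-way automaton on infinite words with a Muller acceptance
condition. No initial state is singled out, since as a look-ahead it is started
in each of its states. -/
structure MullerAutomaton (α : Type*) (S : Type*) where
  step : S → α → Set S
  acc : Set (Set S)

/-- `L(A, p)`: the infinite words having a final run that starts in `p`. -/
def MullerAutomaton.langFrom {α S : Type*} (A : MullerAutomaton α S) (p : S) : Set (ℕ → α) :=
  {w | ∃ ρ : ℕ → S, ρ 0 = p ∧ (∀ n, ρ (n + 1) ∈ A.step (ρ n) (w n)) ∧ infSet ρ ∈ A.acc}

/-- Directions of the head of a two-way transducer. -/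
inductive HeadDir
  | left
  | right

/-- A two-way transducer with look-around, Muller acceptance condition, and a partial
transition function. A transition may depend on the current state, on the symbol under the head,
on a state of the look-ahead automaton, and on the state that the look-behind automaton
reaches on the part of the tape strictly to the left of the head
(so the accepting states of the look-behind automaton play no role).
Determinism is the predicate `IsDeterministic` below. -/
structure TwoWayTransducer (Sig : Type*) (Gam : Type*) where
  State : Type
  Ahead : Type
  Behind : Type
  finState : Finite State
  finAhead : Finite Ahead
  finBehind : Finite Behind
  init : State
  lookAhead : MullerAutomaton (Option Sig) Ahead
  lookBehind : DFA (Option Sig) Behind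
  trans : State → Option Sig → Ahead → Behind → Option (State × List Gam × HeadDir)
  acc : Set (Set State)

namespace TwoWayTransducer

variable {Sig Gam : Type*} (T : TwoWayTransducer Sig Gam)

/-- State of the look-behind automaton after the tape cells `0, …, i - 1`. -/
def behindState (w : ℕ → Sig) (i : ℕ) : T.Behind :=
  T.lookBehind.eval (wordPrefix (inputTape w) i)

/-- The content of the tape from cell `i` on is in the look-ahead language of `p`. -/
def AheadHolds (w : ℕ → Sig) (i : ℕ) (p : T.Ahead) : Prop :=
  (fun n => inputTape w (i + n)) ∈ T.lookAhead.langFrom p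

/-- The transition that is taken in configuration `(q, i)` with look-ahead state `p`. -/
def transAt (w : ℕ → Sig) (q : T.State) (i : ℕ) (p : T.Ahead) :
    Option (T.State × List Gam × HeadDir) :=
  T.trans q (inputTape w i) p (T.behindState w i)

/-- On every input, in every configuration, at most one look-ahead state both accepts
the remaining input and enables a transition. -/
def IsDeterministic : Prop :=
  ∀ (w : ℕ → Sig) (q : T.State) (i : ℕ) (p p' : T.Ahead),
    T.AheadHolds w i p → T.AheadHolds w i p' →
    (T.transAt w q i p).isSome → (T.transAt w q i p').isSome → p = p'

/-- `(q, i)` is followed by `(q', i')` with output `γ`. A move to the left of the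
left delimiter is impossible. -/
def Step (w : ℕ → Sig) (c : T.State × ℕ) (γ : List Gam) (c' : T.State × ℕ) : Prop :=
  ∃ p, T.AheadHolds w c.2 p ∧
    ((T.transAt w c.1 c.2 p = some (c'.1, γ, HeadDir.right) ∧ c'.2 = c.2 + 1) ∨
     (T.transAt w c.1 c.2 p = some (c'.1, γ, HeadDir.left) ∧ c.2 = c'.2 + 1))

/-- An accepting run with configurations `ρ` and outputs `γ`: an infinite run from the initial
configuration that reads the whole input and satisfies the Muller condition. -/
structure IsAcceptingRun (w : ℕ → Sig) (ρ : ℕ → T.State × ℕ) (γ : ℕ → List Gam) : Prop where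
  start : ρ 0 = (T.init, 0)
  step : ∀ n, T.Step w (ρ n) (γ n) (ρ (n + 1))
  readsAll : ∀ k, ∃ n, k ≤ (ρ n).2
  muller : infSet (fun n => (ρ n).1) ∈ T.acc

end TwoWayTransducer

/-- The infinite concatenation `γ 0 ++ γ 1 ++ …` is the infinite word `v`. -/
def ConcatEq {α : Type*} (γ : ℕ → List α) (v : ℕ → α) : Prop :=
  (∀ n, ∃ k, (List.range n).flatMap γ = wordPrefix v k) ∧
  ∀ k, ∃ n, k ≤ ((List.range n).flatMap γ).length

/-- `T` realizes `f`: the domain of `f` consists of the words with an accepting run,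
and such a run outputs the (infinite) word `f w`. -/
def TwoWayTransducer.Realizes {Sig Gam : Type*} (T : TwoWayTransducer Sig Gam)
    (f : (ℕ → Sig) →. (ℕ → Gam)) : Prop :=
  (∀ w, w ∈ f.Dom ↔ ∃ ρ γ, T.IsAcceptingRun w ρ γ) ∧
  ∀ w ρ γ, T.IsAcceptingRun w ρ γ → ∀ v ∈ f w, ConcatEq γ v

/-- Regular functions on infinite words: those realized by a deterministic two-way Muller
transducer with look-around. -/
def IsRegularFunction {Sig Gam : Type*} (f : (ℕ → Sig) →. (ℕ → Gam)) : Prop :=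
  ∃ T : TwoWayTransducer Sig Gam, T.IsDeterministic ∧ T.Realizes f

/-! ### Computable functions: deterministic machines with three tapes -/

/-- Moves of the head on the work tape. -/
inductive WorkMove
  | left
  | stay
  | right

/-- What a machine does in one step: the next state, the symbol written on the work tape, the move
on the work tape, whether the input head advances by one cell, and the symbol (if any)
appended to the output tape. -/
structure MachineAction (State Work Gam : Type*) where
  next : State
  write : Work
  move : WorkMove
  advance : Bool
  out : Option Gam

/-- A deterministic machine with a read-only one-way input tape, a two-way work tape and a
write-only one-way output tape. The symbol `none` read on the input or on the work tape is
the left delimiter. -/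
structure StreamMachine (Sig : Type*) (Gam : Type*) where
  State : Type
  Work : Type
  finState : Finite State
  finWork : Finite Work
  blank : Work
  init : State
  trans : State → Option Sig → Option Work → Option (MachineAction State Work Gam)

namespace StreamMachine

variable {Sig Gam : Type*} (M : StreamMachine Sig Gam)

/-- Configurations. On the work tape the delimiter is at position `0`, and position `k + 1`
holds `cells k`. -/
structure Config where
  state : M.State
  inPos : ℕ
  cells : ℕ → M.Work
  workPos : ℕ
  output : List Gam

/-- Start: both heads are on the left delimiters, the work tape is blank, no output. -/
def initConfig : M.Config :=
  ⟨M.init, 0, fun _ => M.blank, 0, []⟩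

/-- The symbol of the work tape at position `k`. -/
def readWork (cells : ℕ → M.Work) : ℕ → Option M.Work
  | 0 => none
  | k + 1 => some (cells k)

/-- Write on the work tape at position `k`; the delimiter cannot be overwritten. -/
def writeWork (cells : ℕ → M.Work) (s : M.Work) : ℕ → (ℕ → M.Work)
  | 0 => cells
  | k + 1 => Function.update cells k s

/-- Move on the work tape; a left move on the delimiter has no effect. -/
def movedPos (k : ℕ) : WorkMove → ℕ
  | WorkMove.left => k - 1
  | WorkMove.stay => k
  | WorkMove.right => k + 1

/-- One step on input `x`; where no transition is defined, the machine stops. -/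
def step (x : ℕ → Sig) (c : M.Config) : M.Config :=
  match M.trans c.state (inputTape x c.inPos) (M.readWork c.cells c.workPos) with
  | none => c
  | some a =>
    { state := a.next
      inPos := if a.advance then c.inPos + 1 else c.inPos
      cells := M.writeWork c.cells a.write c.workPos
      workPos := movedPos c.workPos a.move
      output := c.output ++ a.out.toList }

/-- The configuration after `n` steps on input `x`. -/
def configAt (x : ℕ → Sig) (n : ℕ) : M.Config :=
  (M.step x)^[n] M.initConfig

open Classical in
/-- `M(x, j)`: the output produced until the input head moves from position `j` to position
`j + 1`, and the empty word if this never happens. -/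
noncomputable def outputUpTo (x : ℕ → Sig) (j : ℕ) : List Gam :=
  if h : ∃ n, (M.configAt x n).inPos = j + 1 then (M.configAt x (Nat.find h)).output else []

/-- `M` computes `f`: on every `x` in the domain of `f`, every prefix of `f x` is a prefix
of some `M(x, j)`. -/
def Computes (f : (ℕ → Sig) →. (ℕ → Gam)) : Prop :=
  ∀ x, ∀ y ∈ f x, ∀ i, ∃ j, wordPrefix y i <+: M.outputUpTo x j

end StreamMachine

/-- Computable functions on infinite words. -/
def IsComputableFunction {Sig Gam : Type*} (f : (ℕ → Sig) →. (ℕ → Gam)) : Prop :=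
  ∃ M : StreamMachine Sig Gam, M.Computes f

/-! ### The mismatch problem -/

/-- Some extension `x` of `u` in the domain of `f` is such that `v` and `f x` differ at some
position of `v`. -/
def HasMismatch {Sig Gam : Type*} (f : (ℕ → Sig) →. (ℕ → Gam)) (u : List Sig) (v : List Gam) :
    Prop :=
  ∃ x, ∃ z ∈ f x, u = wordPrefix x u.length ∧ ∃ i, ∃ h : i < v.length, v[i] ≠ z i

/-- The mismatch problem of `f` (given `u` and `v`, does `HasMismatch f u v` hold?) is decidable.
The letters of the finite alphabets are presented as numbers, in any way. -/
def MismatchDecidable {Sig Gam : Type*} (f : (ℕ → Sig) →. (ℕ → Gam)) : Prop :=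
  ∀ (n m : ℕ) (e : Fin n ≃ Sig) (e' : Fin m ≃ Gam),
    ComputablePred fun p : List (Fin n) × List (Fin m) =>
      HasMismatch f (p.1.map e) (p.2.map e')

/-! Both halves reduce to one question about a finite graph: which letters can stand at position `i`
of `f x` when only a prefix of `x` is known? The accepting run of the transducer is encoded cell by
cell. Each tape cell carries a finite amount of information about the visits of the run: which
states occur there, in which order, which are entered from the left, and whether they lie before, at
or after one distinguished step. A labelling of the tape is then an infinite path in a finite graph.
Its edges check consistency between neighbouring cells, and its acceptance condition depends only on
tails. The weight of a cell is the number of letters output there before the distinguished letter,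
so the total weight of an accepting path is the position of that letter (`Realizes.describes`).

Local consistency alone would allow spurious visits that do not belong to the run. Cycles are
excluded by the order at each cell (`lt_of_moves`). Every other spurious visit begins an infinite
backward chain, which acceptance forbids (`exists_run_of_labelling`).

In a weighted graph with finitely many vertices, the set of vertices that start an accepting path of
total weight `n` is produced by a finite automaton reading `n` in unary (`exists_unary_automaton`).
A finite word reaches finitely many pairs of a vertex and a collected weight. Combining the two
describes the possible letters at position `i` after a prefix (`Describes.possible_iff`). For the
mismatch problem only positions below `|v|` matter, so the search is finite. The automaton may be
obtained nonconstructively, because it depends only on `f` and is a constant of the algorithm.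

For computability, a machine stores on its work tape the vertices reached with each weight. After
each input cell it outputs the next letter if exactly one letter is possible there. Such an output
is always correct, and continuity forces the possible letter to become unique after enough input, so
the output grows forever. Conversely, `M(x, j)` depends only on the first `j` letters of `x`, so a
computable function is continuous. -/

/-! ### Weighted path systems -/

/-- A graph whose vertices carry a weight, a tape symbol and an output letter, together with an
acceptance condition on infinite paths that depends only on their tails. -/
structure PathSystem (Sig Gam S : Type*) where
  edge : S → S → Prop
  weight : S → ℕ
  sym : S → Option Sig
  letter : S → Gam
  acc : (ℕ → S) → Prop
  acc_tail : ∀ ρ : ℕ → S, (∀ n, edge (ρ n) (ρ (n + 1))) → (acc (fun n => ρ (n + 1)) ↔ acc ρ)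
  edge_sym : ∀ s s', edge s s' → sym s' ≠ none
  edge_letter : ∀ s s', edge s s' → letter s' = letter s

namespace PathSystem

variable {Sig Gam S : Type*} (N : PathSystem Sig Gam S)

/-- The weights along `ρ` add up to `i`. -/
def HasTotal (ρ : ℕ → S) (i : ℕ) : Prop :=
  ∃ m, ∑ n ∈ Finset.range m, N.weight (ρ n) = i ∧ ∀ n, m ≤ n → N.weight (ρ n) = 0

/-- `ρ` is an accepting path of total weight `i`. -/
structure IsAccepting (ρ : ℕ → S) (i : ℕ) : Prop where
  edge : ∀ n, N.edge (ρ n) (ρ (n + 1))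
  acc : N.acc ρ
  total : N.HasTotal ρ i

/-- The accepting paths of total weight `i` over the tape of `x` with letter `c` witness that the
`i`-th letter of `f x` is `c`. -/
def Describes (f : (ℕ → Sig) →. (ℕ → Gam)) : Prop :=
  ∀ x i c, (∃ y ∈ f x, y i = c) ↔
    ∃ ρ, N.IsAccepting ρ i ∧ (∀ n, N.sym (ρ n) = inputTape x n) ∧ N.letter (ρ 0) = c

/-- Transport of a path system along an equivalence of the vertex types. -/
def map {S' : Type*} (e : S ≃ S') : PathSystem Sig Gam S' where
  edge s s' := N.edge (e.symm s) (e.symm s')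
  weight s := N.weight (e.symm s)
  sym s := N.sym (e.symm s)
  letter s := N.letter (e.symm s)
  acc ρ := N.acc (fun n => e.symm (ρ n))
  acc_tail ρ h := N.acc_tail (fun n => e.symm (ρ n)) h
  edge_sym _ _ h := N.edge_sym _ _ h
  edge_letter _ _ h := N.edge_letter _ _ h

theorem Describes.map {N : PathSystem Sig Gam S} {f : (ℕ → Sig) →. (ℕ → Gam)}
    (h : N.Describes f) {S' : Type*} (e : S ≃ S') : (N.map e).Describes f := by
  intro x i c
  rw [h x i c]
  constructor
  · rintro ⟨ρ, ⟨h1, h2, h3⟩, h4, h5⟩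
    refine ⟨fun n => e (ρ n), ⟨?_, ?_, ?_⟩, ?_, ?_⟩ <;>
      simpa [PathSystem.map, HasTotal] using by assumption
  · rintro ⟨ρ, ⟨h1, h2, h3⟩, h4, h5⟩
    exact ⟨fun n => e.symm (ρ n), ⟨h1, h2, h3⟩, h4, h5⟩

end PathSystem

/-! ### Local descriptions of accepting runs -/

namespace TwoWayTransducer

variable {Sig Gam : Type*} (T : TwoWayTransducer Sig Gam)

/-- The information attached to one cell of the tape, relative to a distinguished step of an
accepting run: the `phase` of a state `q` is `0` if the run never is in state `q` at this cell, and
`1`, `2`, `3` if it is before, at, or after the distinguished step; `fromLeft` are the states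
that are entered from the left; `lt` is the order in time; `letter` is the letter at position `off`
of the output of the distinguished step. -/
structure CellInfo (L : ℕ) where
  sym : Option Sig
  letter : Gam
  ahead : Set T.Ahead
  behind : T.Behind
  phase : T.State → Fin 4
  fromLeft : Set T.State
  lt : T.State → T.State → Prop
  off : Fin L

variable {T} {L : ℕ}

instance [Finite Sig] [Finite Gam] : Finite (T.CellInfo L) := by
  have := T.finState
  have := T.finAhead
  have := T.finBehind
  have : Finite (T.State → T.State → Prop) := inferInstance
  refine Finite.of_injective (β := Option Sig × Gam × Set T.Ahead × T.Behind × (T.State → Fin 4) ×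
    Set T.State × (T.State → T.State → Prop) × Fin L)
    (fun s => (s.sym, s.letter, s.ahead, s.behind, s.phase, s.fromLeft, s.lt, s.off)) ?_
  rintro ⟨⟩ ⟨⟩ h
  simp only [Prod.mk.injEq] at h
  obtain ⟨rfl, rfl, rfl, rfl, rfl, rfl, rfl, rfl⟩ := h
  rfl

/-- The transition `r` is possible in state `q` at a cell with the given information. -/
def CellInfo.Act (s : T.CellInfo L) (q : T.State) (r : T.State × List Gam × HeadDir) : Prop :=
  ∃ p ∈ s.ahead, T.trans q s.sym p s.behind = some r

/-- The phases of two consecutive configurations of a run. -/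
def PhaseStep (a b : Fin 4) : Prop :=
  (a = 1 ∧ (b = 1 ∨ b = 2)) ∨ ((a = 2 ∨ a = 3) ∧ b = 3)

theorem PhaseStep.ne_zero {a b : Fin 4} (h : PhaseStep a b) : b ≠ 0 := by
  rcases h with ⟨-, rfl | rfl⟩ | ⟨-, rfl⟩ <;> decide

/-- Compatibility of the information at two neighbouring cells. -/
structure CellEdge (s s' : T.CellInfo L) : Prop where
  sym : s'.sym ≠ none
  letter : s'.letter = s.letter
  ahead : s.ahead = {p | ∃ p' ∈ T.lookAhead.step p s.sym, p' ∈ s'.ahead}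
  behind : s'.behind = T.lookBehind.step s.behind s.sym
  behind_start : s.sym = none → s.behind = T.lookBehind.start
  act : ∀ q, s.phase q ≠ 0 → ∃ r, s.Act q r
  act_start : ∀ q q' g, s.sym = none → s.phase q ≠ 0 → ¬ s.Act q (q', g, HeadDir.left)
  right : ∀ q q' g, s.phase q ≠ 0 → s.Act q (q', g, HeadDir.right) →
    PhaseStep (s.phase q) (s'.phase q')
  left : ∀ q q' g, s'.phase q ≠ 0 → s'.Act q (q', g, HeadDir.left) →
    PhaseStep (s'.phase q) (s.phase q')
  init : s.sym = none → s.phase T.init = 1 ∨ s.phase T.init = 2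
  pred_left : ∀ q ∈ s'.fromLeft, s'.phase q ≠ 0 →
    ∃ q' g, s.phase q' ≠ 0 ∧ s.Act q' (q, g, HeadDir.right)
  pred_right : ∀ q ∉ s.fromLeft, s.phase q ≠ 0 → ¬ (s.sym = none ∧ q = T.init) →
    ∃ q' g, s'.phase q' ≠ 0 ∧ s'.Act q' (q, g, HeadDir.left)
  pred_start : s.sym = none → s.fromLeft = ∅
  lt_irrefl : ∀ q, ¬ s.lt q q
  lt_trans : ∀ q q' q'', s.lt q q' → s.lt q' q'' → s.lt q q''
  lt_right : ∀ a b c d g g', s.phase a ≠ 0 → s'.phase b ≠ 0 → s'.phase c ≠ 0 → s.phase d ≠ 0 →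
    s.Act a (b, g, HeadDir.right) → s'.Act c (d, g', HeadDir.left) → (b = c ∨ s'.lt b c) →
    s.lt a d
  lt_left : ∀ a b c d g g', s'.phase a ≠ 0 → s.phase b ≠ 0 → s.phase c ≠ 0 → s'.phase d ≠ 0 →
    s'.Act a (b, g, HeadDir.left) → s.Act c (d, g', HeadDir.right) → (b = c ∨ s.lt b c) →
    s'.lt a d
  letter_off : ∀ q q' g d, s.phase q = 2 → s.Act q (q', g, d) → g[(s.off : ℕ)]? = some s.letter

/-- A move between configurations, according to the information attached to the cells. -/
def Move (σ : ℕ → T.CellInfo L) (c : T.State × ℕ) (g : List Gam) (c' : T.State × ℕ) : Prop :=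
  ((σ c.2).Act c.1 (c'.1, g, HeadDir.right) ∧ c'.2 = c.2 + 1) ∨
  ((σ c.2).Act c.1 (c'.1, g, HeadDir.left) ∧ c.2 = c'.2 + 1)

/-- The configuration `c` is visited, according to the information attached to the cells. -/
def Visited (σ : ℕ → T.CellInfo L) (c : T.State × ℕ) : Prop :=
  (σ c.2).phase c.1 ≠ 0

/-- The local orders cannot be fooled by long detours: an excursion to one side that returns to its
cell is handled by induction on its length, since its inner part is a shorter path between two
visits to the neighbouring cell. Together with irreflexivity this rules out cyclic runs. -/
theorem lt_of_moves {σ : ℕ → T.CellInfo L} (hσ : ∀ n, CellEdge (σ n) (σ (n + 1))) (l : ℕ) :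
    ∀ c : ℕ → T.State × ℕ, 0 < l → (∀ k < l, ∃ g, Move σ (c k) g (c (k + 1))) →
      (∀ k ≤ l, Visited σ (c k)) → (c 0).2 = (c l).2 → (σ (c 0).2).lt (c 0).1 (c l).1 := by
  induction l using Nat.strong_induction_on with
  | _ l ih =>
  intro c hl hm hv hn
  -- If the path meets its cell in between, the two pieces combine by transitivity. Otherwise, as
  -- the head moves by one cell at a time, the path stays strictly on one side, and `lt_right` or
  -- `lt_left` applies.
  by_cases hmid : ∃ m, 0 < m ∧ m < l ∧ (c m).2 = (c 0).2
  · obtain ⟨m, hm0, hml, hmn⟩ := hmid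
    have h1 := ih m hml c hm0 (fun k hk => hm k (by omega)) (fun k hk => hv k (by omega)) hmn.symm
    have h2 := ih (l - m) (by omega) (fun k => c (m + k)) (by omega)
      (fun k hk => hm (m + k) (by omega)) (fun k hk => hv (m + k) (by omega))
      (by rw [show m + (l - m) = l by omega]; simp [hmn, hn])
    rw [show m + (l - m) = l by omega] at h2
    simp only [add_zero, hmn] at h2
    exact (hσ _).lt_trans _ _ _ h1 h2
  · push Not at hmid
    obtain ⟨g, h0⟩ := hm 0 hl
    have hl1 : 1 < l := by
      by_contra hc
      obtain rfl : l = 1 := by omega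
      rcases h0 with ⟨_, h⟩ | ⟨_, h⟩ <;> simp at h <;> omega
    obtain ⟨g', he⟩ := hm (l - 1) (by omega)
    rw [show l - 1 + 1 = l by omega] at he
    have hin : (c 1).1 = (c (l - 1)).1 ∨
        ((c 1).2 = (c (l - 1)).2 → (σ (c 1).2).lt (c 1).1 (c (l - 1)).1) := by
      by_cases h2 : l = 2
      · subst h2; exact Or.inl rfl
      · right
        intro h
        have := ih (l - 2) (by omega) (fun k => c (1 + k)) (by omega)
          (fun k hk => hm (1 + k) (by omega)) (fun k hk => hv (1 + k) (by omega))
          (by rw [show 1 + (l - 2) = l - 1 by omega]; exact h)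
        rwa [show 1 + (l - 2) = l - 1 by omega] at this
    rcases h0 with ⟨h0, h0'⟩ | ⟨h0, h0'⟩
    · have hgt : ∀ k, 1 + k < l → (c 0).2 < (c (1 + k)).2 := by
        intro k
        induction k with
        | zero => intro _; simp at h0' ⊢; omega
        | succ k ihk =>
          intro hk
          have := ihk (by omega)
          have hne := hmid (1 + (k + 1)) (by omega) hk
          obtain ⟨_, h⟩ := hm (1 + k) (by omega)
          rw [show 1 + k + 1 = 1 + (k + 1) by omega] at h
          rcases h with ⟨_, h⟩ | ⟨_, h⟩ <;> omega
      have hlast := hgt (l - 2) (by omega)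
      rw [show 1 + (l - 2) = l - 1 by omega] at hlast
      rcases he with ⟨_, he'⟩ | ⟨he, he'⟩
      · omega
      simp only [zero_add] at h0 h0'
      have e1 : (c (l - 1)).2 = (c 0).2 + 1 := by omega
      have v1 := hv 1 hl1.le
      have v2 := hv (l - 1) (by omega)
      have v3 := hv l le_rfl
      simp only [Visited, h0', e1, ← hn] at v1 v2 v3
      rw [e1] at he
      refine (hσ _).lt_right _ _ _ _ _ _ (hv 0 hl.le) v1 v2 v3 h0 he ?_
      rcases hin with h | h
      · exact Or.inl h
      · rw [← h0']; exact Or.inr (h (by omega))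
    · simp only [zero_add] at h0 h0'
      have hgt : ∀ k, 1 + k < l → (c (1 + k)).2 < (c 0).2 := by
        intro k
        induction k with
        | zero => intro _; simp at h0' ⊢; omega
        | succ k ihk =>
          intro hk
          have := ihk (by omega)
          have hne := hmid (1 + (k + 1)) (by omega) hk
          obtain ⟨_, h⟩ := hm (1 + k) (by omega)
          rw [show 1 + k + 1 = 1 + (k + 1) by omega] at h
          rcases h with ⟨_, h⟩ | ⟨_, h⟩ <;> omega
      have hlast := hgt (l - 2) (by omega)
      rw [show 1 + (l - 2) = l - 1 by omega] at hlast
      rcases he with ⟨he, he'⟩ | ⟨_, he'⟩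
      swap
      · omega
      have e1 : (c (l - 1)).2 = (c 1).2 := by omega
      have v0 := hv 0 hl.le
      have v1 := hv 1 hl1.le
      have v2 := hv (l - 1) (by omega)
      have v3 := hv l le_rfl
      simp only [Visited, e1, ← hn] at v1 v2 v3
      simp only [Visited, h0'] at v0 v3
      rw [e1] at he
      rw [h0'] at h0 ⊢
      refine (hσ _).lt_left _ _ _ _ _ _ v0 v1 v2 v3 h0 he ?_
      rcases hin with h | h
      · exact Or.inl h
      · exact Or.inr (h e1.symm)

/-- Visited configurations that follow one another backwards in time, without end. -/
def BackChain (σ : ℕ → T.CellInfo L) (c : ℕ → T.State × ℕ) : Prop :=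
  ∀ k, Visited σ (c k) ∧ ∃ g, Move σ (c (k + 1)) g (c k)

theorem BackChain.injective {σ : ℕ → T.CellInfo L} (hσ : ∀ n, CellEdge (σ n) (σ (n + 1)))
    {c : ℕ → T.State × ℕ} (hc : BackChain σ c) : Function.Injective c := by
  have key : ∀ k l, k < l → c k ≠ c l := by
    intro k l hkl h
    have := lt_of_moves hσ (l - k) (fun j => c (l - j)) (by omega)
      (fun j hj => by
        have := (hc (l - (j + 1))).2
        rwa [show l - (j + 1) + 1 = l - j by omega] at this)
      (fun j _ => (hc _).1)
      (by simp only [tsub_zero]; rw [show l - (l - k) = k by omega, h])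
    simp only [tsub_zero] at this
    rw [show l - (l - k) = k by omega, h] at this
    exact (hσ _).lt_irrefl _ this
  intro k l h
  by_contra hne
  rcases Nat.lt_or_gt_of_ne hne with h' | h'
  · exact key _ _ h' h
  · exact key _ _ h' h.symm

theorem Move.shift {σ : ℕ → T.CellInfo L} {q q' : T.State} {n n' : ℕ} {g : List Gam} :
    Move σ (q, n + 1) g (q', n' + 1) ↔ Move (fun k => σ (k + 1)) (q, n) g (q', n') := by
  simp [Move]

/-- This makes the exclusion of backward chains a tail condition, as `PathSystem` demands. -/
theorem exists_backChain_tail_iff {σ : ℕ → T.CellInfo L}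
    (hσ : ∀ n, CellEdge (σ n) (σ (n + 1))) :
    (∃ c, BackChain (fun n => σ (n + 1)) c) ↔ ∃ c, BackChain σ c := by
  constructor
  · rintro ⟨c, hc⟩
    refine ⟨fun k => ((c k).1, (c k).2 + 1), fun k => ⟨(hc k).1, ?_⟩⟩
    obtain ⟨g, h⟩ := (hc k).2
    exact ⟨g, Move.shift.2 h⟩
  · rintro ⟨c, hc⟩
    have := T.finState
    -- A backward chain never repeats a configuration and there are finitely many states, so it
    -- leaves cell `0` for good; the rest of it lives on the tail.
    have hfin : {k | (c k).2 = 0}.Finite := by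
      refine Set.Finite.of_finite_image (f := c) ?_ (hc.injective hσ).injOn
      refine (Set.finite_univ.prod (Set.finite_singleton 0)).subset ?_
      rintro _ ⟨k, hk, rfl⟩
      exact ⟨trivial, hk⟩
    obtain ⟨K, hK⟩ := hfin.bddAbove
    have hpos : ∀ k, 0 < (c (K + 1 + k)).2 := by
      intro k
      by_contra h
      have := hK (show K + 1 + k ∈ {k | (c k).2 = 0} by simpa using h)
      omega
    refine ⟨fun k => ((c (K + 1 + k)).1, (c (K + 1 + k)).2 - 1), fun k => ⟨?_, ?_⟩⟩
    · have := (hc (K + 1 + k)).1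
      simp only [Visited] at this ⊢
      rwa [Nat.sub_add_cancel (hpos k)]
    · obtain ⟨g, h⟩ := (hc (K + 1 + k)).2
      refine ⟨g, Move.shift.1 ?_⟩
      rw [Nat.sub_add_cancel (hpos k), Nat.sub_add_cancel (hpos (k + 1))]
      exact h

/-- The look-ahead sets are eventually the right ones. -/
def AheadEventually (σ : ℕ → T.CellInfo L) : Prop :=
  ∃ m, ∀ n, m ≤ n → (σ n).ahead = {p | (fun k => (σ (n + k)).sym) ∈ T.lookAhead.langFrom p}

/-- Acceptance of a labelling of the tape. -/
structure CellAcc (σ : ℕ → T.CellInfo L) : Prop where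
  chain : ¬ ∃ c, BackChain σ c
  ahead : AheadEventually σ
  muller : {q | ∃ᶠ n in atTop, (σ n).phase q ≠ 0} ∈ T.acc
  before : ∀ᶠ n in atTop, ∀ q, (σ n).phase q ≠ 1

theorem cellAcc_tail (σ : ℕ → T.CellInfo L) (hσ : ∀ n, CellEdge (σ n) (σ (n + 1))) :
    CellAcc (fun n => σ (n + 1)) ↔ CellAcc σ := by
  have h1 := exists_backChain_tail_iff hσ
  have h2 : AheadEventually (fun n => σ (n + 1)) ↔ AheadEventually σ := by
    constructor
    · rintro ⟨m, h⟩
      refine ⟨m + 1, fun n hn => ?_⟩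
      obtain ⟨n, rfl⟩ : ∃ k, n = k + 1 := ⟨n - 1, by omega⟩
      rw [h n (by omega)]
      simp only [add_right_comm]
    · rintro ⟨m, h⟩
      refine ⟨m, fun n hn => ?_⟩
      rw [h (n + 1) (by omega)]
      simp only [add_right_comm]
  have h3 : {q | ∃ᶠ n in atTop, (σ (n + 1)).phase q ≠ 0} =
      {q | ∃ᶠ n in atTop, (σ n).phase q ≠ 0} := by
    ext q
    simp only [Set.mem_ofPred_eq, Filter.Frequently]
    rw [← Filter.eventually_map (m := fun n : ℕ => n + 1) (P := fun n => ¬ (σ n).phase q ≠ 0),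
      Filter.map_add_atTop_eq_nat]
  have h4 : (∀ᶠ n in atTop, ∀ q, (σ (n + 1)).phase q ≠ 1) ↔
      ∀ᶠ n in atTop, ∀ q, (σ n).phase q ≠ 1 := by
    rw [← Filter.eventually_map (m := fun n : ℕ => n + 1) (P := fun n => ∀ q, (σ n).phase q ≠ 1),
      Filter.map_add_atTop_eq_nat]
  constructor
  · rintro ⟨a, b, c, d⟩
    exact ⟨h1.not.1 a, h2.1 b, h3 ▸ c, h4.1 d⟩
  · rintro ⟨a, b, c, d⟩
    exact ⟨h1.not.2 a, h2.2 b, h3.symm ▸ c, h4.2 d⟩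

open Classical in
/-- The length of the output of the transition that is possible in state `q`. -/
noncomputable def CellInfo.outLength (s : T.CellInfo L) (q : T.State) : ℕ :=
  if h : ∃ r, s.Act q r then h.choose.2.1.length else 0

open Classical in
/-- The number of letters that are output in state `q` before the distinguished letter. -/
noncomputable def CellInfo.stateWeight (s : T.CellInfo L) (q : T.State) : ℕ :=
  if s.phase q = 1 then s.outLength q else if s.phase q = 2 then s.off else 0

variable (T L)

/-- The path system of the local descriptions of accepting runs. -/
noncomputable def pathSystem : PathSystem Sig Gam (T.CellInfo L) where
  edge := CellEdge
  weight s := ∑ᶠ q, s.stateWeight q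
  sym := CellInfo.sym
  letter := CellInfo.letter
  acc := CellAcc
  acc_tail := cellAcc_tail
  edge_sym _ _ h := h.sym
  edge_letter _ _ h := h.letter

end TwoWayTransducer

/-! ### Words and concatenations -/

theorem wordPrefix_succ {α : Type*} (w : ℕ → α) (k : ℕ) :
    wordPrefix w (k + 1) = wordPrefix w k ++ [w k] := by
  simp [wordPrefix, List.range_succ]

@[simp] theorem length_wordPrefix {α : Type*} (w : ℕ → α) (k : ℕ) :
    (wordPrefix w k).length = k := by
  simp [wordPrefix]

@[simp] theorem getElem?_wordPrefix {α : Type*} (w : ℕ → α) {i k : ℕ} (h : i < k) :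
    (wordPrefix w k)[i]? = some (w i) := by
  simp [wordPrefix, h]

theorem length_flatMap_range {α : Type*} (γ : ℕ → List α) (n : ℕ) :
    ((List.range n).flatMap γ).length = ∑ t ∈ Finset.range n, (γ t).length := by
  induction n with
  | zero => simp
  | succ n ih => rw [List.range_succ, List.flatMap_append, List.length_append, ih,
      Finset.sum_range_succ]; simp

theorem ConcatEq.apply_eq {α : Type*} {γ : ℕ → List α} {v : ℕ → α} (h : ConcatEq γ v) {t o : ℕ}
    {c : α} (hc : (γ t)[o]? = some c) : v (∑ s ∈ Finset.range t, (γ s).length + o) = c := by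
  obtain ⟨k, hk⟩ := h.1 (t + 1)
  have ho : o < (γ t).length := (List.getElem?_eq_some_iff.1 hc).1
  have hlen := congrArg List.length hk
  rw [length_flatMap_range, length_wordPrefix, Finset.sum_range_succ] at hlen
  have h2 := getElem?_wordPrefix v (show ∑ s ∈ Finset.range t, (γ s).length + o < k by omega)
  rw [← hk, List.range_succ, List.flatMap_append, ← length_flatMap_range,
    List.getElem?_append_right (by omega)] at h2
  rw [← length_flatMap_range]
  simpa [hc] using h2.symm

theorem ConcatEq.exists_index {α : Type*} {γ : ℕ → List α} {v : ℕ → α} (h : ConcatEq γ v)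
    (i : ℕ) : ∃ t o, ∑ s ∈ Finset.range t, (γ s).length + o = i ∧ (γ t)[o]? = some (v i) := by
  have hex : ∃ n, i < ∑ s ∈ Finset.range n, (γ s).length := by
    obtain ⟨n, hn⟩ := h.2 (i + 1)
    exact ⟨n, by rw [← length_flatMap_range]; omega⟩
  classical
  obtain ⟨t, ht⟩ : ∃ t, Nat.find hex = t + 1 := by
    refine ⟨Nat.find hex - 1, ?_⟩
    have : Nat.find hex ≠ 0 := by
      intro h0
      have := Nat.find_spec hex
      rw [h0] at this
      simp at this
    omega
  have h1 := Nat.find_spec hex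
  have h2 := Nat.find_min hex (m := t) (by omega)
  rw [ht, Finset.sum_range_succ] at h1
  refine ⟨t, i - ∑ s ∈ Finset.range t, (γ s).length, by omega, ?_⟩
  have hlt : i - ∑ s ∈ Finset.range t, (γ s).length < (γ t).length := by omega
  rw [List.getElem?_eq_getElem hlt, Option.some_inj]
  have := h.apply_eq (List.getElem?_eq_getElem hlt)
  rw [← this]
  congr 1
  omega

theorem infSet_tail {α : Type*} (ρ : ℕ → α) : infSet (fun n => ρ (n + 1)) = infSet ρ := by
  ext q
  simp only [infSet, Set.mem_ofPred_eq, Filter.Frequently]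
  rw [← Filter.eventually_map (m := fun n : ℕ => n + 1) (P := fun n => ¬ ρ n = q),
    Filter.map_add_atTop_eq_nat]

theorem MullerAutomaton.mem_langFrom_iff {α S : Type*} (A : MullerAutomaton α S) (p : S)
    (w : ℕ → α) :
    w ∈ A.langFrom p ↔ ∃ p' ∈ A.step p (w 0), (fun n => w (n + 1)) ∈ A.langFrom p' := by
  constructor
  · rintro ⟨ρ, rfl, h1, h2⟩
    exact ⟨ρ 1, h1 0, fun n => ρ (n + 1), rfl, fun n => h1 (n + 1), by rwa [infSet_tail]⟩
  · rintro ⟨p', hp, ρ, rfl, h1, h2⟩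
    refine ⟨fun n => Nat.casesOn n p ρ, rfl, ?_, ?_⟩
    · rintro (_ | n)
      · exact hp
      · exact h1 n
    · rw [← infSet_tail]; exact h2

/-! ### From accepting labellings to accepting runs -/

namespace TwoWayTransducer

variable {Sig Gam : Type*} {T : TwoWayTransducer Sig Gam} {L : ℕ}

theorem behindState_succ (w : ℕ → Sig) (n : ℕ) :
    T.behindState w (n + 1) = T.lookBehind.step (T.behindState w n) (inputTape w n) := by
  simp [behindState, wordPrefix_succ]

theorem aheadHolds_iff (w : ℕ → Sig) (n : ℕ) (p : T.Ahead) :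
    T.AheadHolds w n p ↔
      ∃ p' ∈ T.lookAhead.step p (inputTape w n), T.AheadHolds w (n + 1) p' := by
  rw [AheadHolds, MullerAutomaton.mem_langFrom_iff]
  simp only [AheadHolds, add_zero, add_right_comm, add_assoc]

theorem IsDeterministic.trans_unique (hT : T.IsDeterministic) {w : ℕ → Sig} {q : T.State} {n : ℕ}
    {p p' : T.Ahead} {r r' : T.State × List Gam × HeadDir} (hp : T.AheadHolds w n p)
    (hp' : T.AheadHolds w n p') (hr : T.transAt w q n p = some r)
    (hr' : T.transAt w q n p' = some r') : r = r' := by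
  obtain rfl := hT w q n p p' hp hp' (by simp [hr]) (by simp [hr'])
  simpa [hr] using hr'

theorem IsDeterministic.step_unique (hT : T.IsDeterministic) {w : ℕ → Sig} {c c' c'' : T.State × ℕ}
    {g g' : List Gam} (h : T.Step w c g c') (h' : T.Step w c g' c'') : g = g' ∧ c' = c'' := by
  obtain ⟨p, hp, h⟩ := h
  obtain ⟨p', hp', h'⟩ := h'
  rcases h with ⟨h, e⟩ | ⟨h, e⟩ <;> rcases h' with ⟨h', e'⟩ | ⟨h', e'⟩ <;>
    have := hT.trans_unique hp hp' h h' <;> simp only [Prod.mk.injEq, reduceCtorEq, and_false] at this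
  · exact ⟨this.2.1, Prod.ext this.1 (by omega)⟩
  · exact ⟨this.2.1, Prod.ext this.1 (by omega)⟩

/-- The labelling `σ` describes the tape of `w` correctly. -/
structure IsLabelling (w : ℕ → Sig) (σ : ℕ → T.CellInfo L) : Prop where
  sym : ∀ n, (σ n).sym = inputTape w n
  ahead : ∀ n, (σ n).ahead = {p | T.AheadHolds w n p}
  behind : ∀ n, (σ n).behind = T.behindState w n

theorem IsLabelling.act_iff {w : ℕ → Sig} {σ : ℕ → T.CellInfo L} (h : IsLabelling w σ) {n : ℕ}
    {q : T.State} {r : T.State × List Gam × HeadDir} :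
    (σ n).Act q r ↔ ∃ p, T.AheadHolds w n p ∧ T.transAt w q n p = some r := by
  simp [CellInfo.Act, transAt, h.sym, h.ahead, h.behind]

theorem IsLabelling.move_iff {w : ℕ → Sig} {σ : ℕ → T.CellInfo L} (h : IsLabelling w σ)
    {c c' : T.State × ℕ} {g : List Gam} : Move σ c g c' ↔ T.Step w c g c' := by
  simp only [Move, Step, h.act_iff]
  constructor
  · rintro (⟨⟨p, h1, h2⟩, h3⟩ | ⟨⟨p, h1, h2⟩, h3⟩)
    · exact ⟨p, h1, Or.inl ⟨h2, h3⟩⟩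
    · exact ⟨p, h1, Or.inr ⟨h2, h3⟩⟩
  · rintro ⟨p, h1, ⟨h2, h3⟩ | ⟨h2, h3⟩⟩
    · exact Or.inl ⟨⟨p, h1, h2⟩, h3⟩
    · exact Or.inr ⟨⟨p, h1, h2⟩, h3⟩

theorem IsLabelling.act_unique (hT : T.IsDeterministic) {w : ℕ → Sig} {σ : ℕ → T.CellInfo L}
    (h : IsLabelling w σ) {n : ℕ} {q : T.State} {r r' : T.State × List Gam × HeadDir}
    (hr : (σ n).Act q r) (hr' : (σ n).Act q r') : r = r' := by
  obtain ⟨p, hp, h1⟩ := h.act_iff.1 hr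
  obtain ⟨p', hp', h2⟩ := h.act_iff.1 hr'
  exact hT.trans_unique hp hp' h1 h2

/-- Look-behind states are determined from left to right, starting at the delimiter. Look-ahead sets
are determined from right to left, so it suffices that they are eventually correct. -/
theorem isLabelling_of_edges {w : ℕ → Sig} {σ : ℕ → T.CellInfo L}
    (hσ : ∀ n, CellEdge (σ n) (σ (n + 1))) (ha : AheadEventually σ)
    (hs : ∀ n, (σ n).sym = inputTape w n) : IsLabelling w σ := by
  refine ⟨hs, ?_, ?_⟩
  · obtain ⟨m, hm⟩ := ha
    have hlast : ∀ n, m ≤ n → (σ n).ahead = {p | T.AheadHolds w n p} := by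
      intro n hn
      rw [hm n hn]
      simp only [hs]
      rfl
    have hstep : ∀ n, (σ (n + 1)).ahead = {p | T.AheadHolds w (n + 1) p} →
        (σ n).ahead = {p | T.AheadHolds w n p} := by
      intro n hn
      rw [(hσ n).ahead]
      ext p
      simp only [Set.mem_ofPred_eq, hn, aheadHolds_iff w n p, hs]
    intro n
    by_cases hn : m ≤ n
    · exact hlast n hn
    · exact Nat.decreasingInduction (motive := fun k _ => (σ k).ahead = {p | T.AheadHolds w k p})
        (fun k _ ih => hstep k ih) (hlast m le_rfl) (not_le.1 hn).le
  · intro n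
    induction n with
    | zero =>
      rw [(hσ 0).behind_start (hs 0)]
      simp [behindState, wordPrefix]
    | succ n ih => rw [(hσ n).behind, ih, behindState_succ, hs]

theorem IsLabelling.outLength_eq (hT : T.IsDeterministic) {w : ℕ → Sig} {σ : ℕ → T.CellInfo L}
    (h : IsLabelling w σ) {c c' : T.State × ℕ} {g : List Gam} (hm : Move σ c g c') :
    (σ c.2).outLength c.1 = g.length := by
  have hex : ∃ r, (σ c.2).Act c.1 r := by
    rcases hm with ⟨hm, _⟩ | ⟨hm, _⟩ <;> exact ⟨_, hm⟩
  rw [CellInfo.outLength, dif_pos hex]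
  rcases hm with ⟨hm, _⟩ | ⟨hm, _⟩ <;> rw [h.act_unique hT hex.choose_spec hm]

/-- The total weight of a labelling, computed along a run `ρ` that visits the visited configurations
in turn. -/
theorem sum_weight_eq (hT : T.IsDeterministic) {w : ℕ → Sig} {σ : ℕ → T.CellInfo L}
    (h : IsLabelling w σ) {ρ : ℕ → T.State × ℕ} {γ : ℕ → List Gam} (hinj : Function.Injective ρ)
    (hm : ∀ t, Move σ (ρ t) (γ t) (ρ (t + 1)))
    (hv : ∀ c, Visited σ c → ∃ t, ρ t = c) {t₀ : ℕ}
    (hph : ∀ t, (σ (ρ t).2).phase (ρ t).1 = if t < t₀ then 1 else if t = t₀ then 2 else 3)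
    {m : ℕ} (hb : ∀ t ≤ t₀, (ρ t).2 < m) :
    ∑ n ∈ Finset.range m, (T.pathSystem L).weight (σ n) =
      ∑ t ∈ Finset.range t₀, (γ t).length + (σ (ρ t₀).2).off := by
  classical
  have := T.finState
  have := Fintype.ofFinite T.State
  simp only [pathSystem, finsum_eq_sum_of_fintype]
  rw [← Finset.sum_product' (f := fun n q => (σ n).stateWeight q)]
  have h1 : ∀ t < t₀, (σ (ρ t).2).stateWeight (ρ t).1 = (γ t).length := by
    intro t ht
    rw [CellInfo.stateWeight, hph, if_pos ht, if_pos rfl, h.outLength_eq hT (hm t)]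
  have h2 : (σ (ρ t₀).2).stateWeight (ρ t₀).1 = (σ (ρ t₀).2).off := by
    rw [CellInfo.stateWeight, hph, if_neg (lt_irrefl _), if_pos rfl, if_neg (by decide), if_pos rfl]
  rw [← h2, ← Finset.sum_congr rfl (fun t ht => h1 t (Finset.mem_range.1 ht)),
    ← Finset.sum_range_succ (fun t => (σ (ρ t).2).stateWeight (ρ t).1)]
  symm
  -- The sum over cells and states is reindexed by time. Pairs that are not visited, or visited
  -- after step `t₀`, have weight zero.
  refine Finset.sum_of_injOn (fun t => ((ρ t).2, (ρ t).1)) ?_ ?_ ?_ (fun _ _ => rfl)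
  · intro a _ b _ hab
    simp only [Prod.mk.injEq] at hab
    exact hinj (Prod.ext hab.2 hab.1)
  · intro t ht
    simp only [Finset.coe_range, Set.mem_Iio] at ht
    simp only [Finset.coe_product, Set.mem_prod, Finset.coe_range, Set.mem_Iio, Finset.coe_univ,
      Set.mem_univ, and_true]
    exact hb t (by omega)
  · rintro ⟨n, q⟩ - hnq
    rw [CellInfo.stateWeight]
    by_cases hq : Visited σ (q, n)
    · obtain ⟨t, ht⟩ := hv _ hq
      have := hph t
      simp only [ht] at this
      by_cases htt : t < t₀ + 1
      · exact absurd ⟨t, by simpa using htt, by simp [ht]⟩ hnq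
      · rw [if_neg (by omega), if_neg (by omega)] at this
        rw [this, if_neg (by decide), if_neg (by decide)]
    · have hq0 : (σ n).phase q = 0 := by simpa [Visited] using hq
      rw [hq0, if_neg (by decide), if_neg (by decide)]

/-- Each pair of a state and a cell is visited at most once, so a state recurs infinitely often in
time exactly when it occurs at infinitely many cells. The Muller condition can thus be read off the
labelling. -/
theorem infSet_run_eq {ρ : ℕ → T.State × ℕ} (hinj : Function.Injective ρ) {σ : ℕ → T.CellInfo L}
    (hv : ∀ c, Visited σ c ↔ ∃ t, ρ t = c) :
    infSet (fun n => (ρ n).1) = {q | ∃ᶠ n in atTop, (σ n).phase q ≠ 0} := by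
  ext q
  simp only [infSet, Set.mem_ofPred_eq, Nat.frequently_atTop_iff_infinite]
  constructor
  · intro h
    refine (h.image (f := fun t => (ρ t).2) ?_).mono ?_
    · intro a ha b hb hab
      exact hinj (Prod.ext (ha.trans hb.symm) hab)
    · rintro _ ⟨t, ht, rfl⟩
      have := (hv (ρ t)).2 ⟨t, rfl⟩
      simp only [Set.mem_ofPred_eq] at ht
      rw [Visited, ht] at this
      exact this
  · intro h
    have h' : ∀ n ∈ {n | (σ n).phase q ≠ 0}, ∃ t, ρ t = (q, n) := fun n hn => (hv (q, n)).1 hn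
    choose! τ hτ using h'
    refine (h.image (f := τ) ?_).mono ?_
    · intro a ha b hb hab
      have := hτ a ha
      rw [hab, hτ b hb] at this
      exact (Prod.mk.inj this).2.symm
    · rintro _ ⟨n, hn, rfl⟩
      simp [hτ n hn]

theorem exists_move {w : ℕ → Sig} {σ : ℕ → T.CellInfo L} (hσ : ∀ n, CellEdge (σ n) (σ (n + 1)))
    (hs : ∀ n, (σ n).sym = inputTape w n) {c : T.State × ℕ} (hc : Visited σ c) :
    ∃ c' g, Move σ c g c' ∧ PhaseStep ((σ c.2).phase c.1) ((σ c'.2).phase c'.1) := by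
  obtain ⟨q, n⟩ := c
  obtain ⟨⟨q', g, d⟩, hr⟩ := (hσ n).act q hc
  cases d with
  | right => exact ⟨(q', n + 1), g, Or.inl ⟨hr, rfl⟩, (hσ n).right q q' g hc hr⟩
  | left =>
    cases n with
    | zero => exact absurd hr ((hσ 0).act_start q q' g (hs 0) hc)
    | succ n => exact ⟨(q', n), g, Or.inr ⟨hr, rfl⟩, (hσ n).left q q' g hc hr⟩

theorem exists_pred {w : ℕ → Sig} {σ : ℕ → T.CellInfo L} (hσ : ∀ n, CellEdge (σ n) (σ (n + 1)))
    (hs : ∀ n, (σ n).sym = inputTape w n) {c : T.State × ℕ} (hc : Visited σ c)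
    (h0 : c ≠ (T.init, 0)) : ∃ c' g, Visited σ c' ∧ Move σ c' g c := by
  obtain ⟨q, n⟩ := c
  by_cases hq : q ∈ (σ n).fromLeft
  · cases n with
    | zero => rw [(hσ 0).pred_start (hs 0)] at hq; exact absurd hq (Set.notMem_empty _)
    | succ n =>
      obtain ⟨q', g, h1, h2⟩ := (hσ n).pred_left q hq hc
      exact ⟨(q', n), g, h1, Or.inl ⟨h2, rfl⟩⟩
  · obtain ⟨q', g, h1, h2⟩ := (hσ n).pred_right q hq hc (by
      rintro ⟨hsym, rfl⟩
      rw [hs] at hsym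
      cases n with
      | zero => exact h0 rfl
      | succ n => simp [inputTape] at hsym)
    exact ⟨(q', n + 1), g, h1, Or.inr ⟨h2, rfl⟩⟩

theorem unbounded_of_injective {ρ : ℕ → T.State × ℕ} (hinj : Function.Injective ρ) (k : ℕ) :
    ∃ t, k ≤ (ρ t).2 := by
  have := T.finState
  by_contra h
  push Not at h
  have : (Set.range ρ).Finite :=
    ((Set.finite_univ (α := T.State)).prod (Set.finite_lt_nat k)).subset (by
      rintro _ ⟨t, rfl⟩
      exact ⟨trivial, h t⟩)
  exact Set.infinite_range_of_injective hinj this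

/-- An accepting labelling of the tape comes from an accepting run. -/
theorem exists_run_of_labelling (hT : T.IsDeterministic) {w : ℕ → Sig} {σ : ℕ → T.CellInfo L}
    (hσ : ∀ n, CellEdge (σ n) (σ (n + 1))) (ha : CellAcc σ)
    (hs : ∀ n, (σ n).sym = inputTape w n) :
    ∃ ρ γ, T.IsAcceptingRun w ρ γ ∧ Function.Injective ρ ∧
      (∀ c, Visited σ c ↔ ∃ t, ρ t = c) ∧
      (∀ t, Move σ (ρ t) (γ t) (ρ (t + 1))) ∧
      ∀ t, PhaseStep ((σ (ρ t).2).phase (ρ t).1) ((σ (ρ (t + 1)).2).phase (ρ (t + 1)).1) := by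
  have hlab := isLabelling_of_edges hσ ha.ahead hs
  have hinit : Visited σ (T.init, 0) := by
    simp only [Visited]
    rcases (hσ 0).init (hs 0) with h | h <;> rw [h] <;> decide
  have hnext : ∀ c : {c // Visited σ c}, ∃ c' : {c // Visited σ c}, ∃ g, Move σ c.1 g c'.1 ∧
      PhaseStep ((σ c.1.2).phase c.1.1) ((σ c'.1.2).phase c'.1.1) := by
    rintro ⟨c, hc⟩
    obtain ⟨c', g, h1, h2⟩ := exists_move hσ hs hc
    exact ⟨⟨c', h2.ne_zero⟩, g, h1, h2⟩
  choose nxt out hmove hphase using hnext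
  let r : ℕ → {c // Visited σ c} := fun t => nxt^[t] ⟨(T.init, 0), hinit⟩
  have hr : ∀ t, r (t + 1) = nxt (r t) := fun t => Function.iterate_succ_apply' _ _ _
  have hm : ∀ t, Move σ (r t).1 (out (r t)) (r (t + 1)).1 := fun t => by rw [hr]; exact hmove _
  have hinj : Function.Injective fun t => (r t).1 := by
    have key : ∀ k l, k < l → (r k).1 ≠ (r l).1 := by
      intro k l hkl h
      have := lt_of_moves hσ (l - k) (fun j => (r (k + j)).1) (by omega)
        (fun j _ => ⟨_, hm (k + j)⟩) (fun j _ => (r (k + j)).2)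
        (by rw [show k + (l - k) = l by omega]; simp [h])
      rw [show k + (l - k) = l by omega] at this
      simp only [add_zero, h] at this
      exact (hσ _).lt_irrefl _ this
    intro k l h
    by_contra hne
    rcases Nat.lt_or_gt_of_ne hne with h' | h'
    · exact key _ _ h' h
    · exact key _ _ h' h.symm
  have hv : ∀ c, Visited σ c ↔ ∃ t, (r t).1 = c := by
    intro c
    constructor
    · intro hc
      by_contra hnot
      -- A visited configuration off the run is not the initial one, so it has a visited
      -- predecessor. By determinism that predecessor is off the run as well, and iterating gives a
      -- forbidden backward chain.
      have hback : ∀ d : {d // Visited σ d ∧ ¬ ∃ t, (r t).1 = d},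
          ∃ d' : {d // Visited σ d ∧ ¬ ∃ t, (r t).1 = d}, ∃ g, Move σ d'.1 g d.1 := by
        rintro ⟨d, hd, hd'⟩
        obtain ⟨d₁, g, h1, h2⟩ := exists_pred hσ hs hd (fun h => hd' ⟨0, h.symm⟩)
        refine ⟨⟨d₁, h1, ?_⟩, g, h2⟩
        rintro ⟨t, rfl⟩
        exact hd' ⟨t + 1, (hT.step_unique (hlab.move_iff.1 (hm t)) (hlab.move_iff.1 h2)).2⟩
      choose prv g hprv using hback
      refine ha.chain ⟨fun k => (prv^[k] ⟨c, hc, hnot⟩).1, fun k => ⟨(prv^[k] _).2.1, ?_⟩⟩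
      simp only [Function.iterate_succ_apply']
      exact ⟨_, hprv _⟩
    · rintro ⟨t, rfl⟩
      exact (r t).2
  refine ⟨fun t => (r t).1, fun t => out (r t), ⟨rfl, fun t => hlab.move_iff.1 (hm t),
    unbounded_of_injective hinj, ?_⟩, hinj, hv, hm, fun t => ?_⟩
  · rw [infSet_run_eq hinj hv]
    exact ha.muller
  · simp only [hr]
    exact hphase _

/-- The phases along a run read `1 … 1 2 3 3 …`, which singles out exactly one distinguished step
once not all of them are `1`. -/
theorem phase_eq_of_phaseStep {φ : ℕ → Fin 4} (h : ∀ t, PhaseStep (φ t) (φ (t + 1)))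
    (h0 : φ 0 = 1 ∨ φ 0 = 2) (hne : ∃ t, φ t ≠ 1) :
    ∃ t₀, ∀ t, φ t = if t < t₀ then 1 else if t = t₀ then 2 else 3 := by
  classical
  have hmin : ∀ t < Nat.find hne, φ t = 1 := fun t ht => not_not.1 (Nat.find_min hne ht)
  have h2 : φ (Nat.find hne) = 2 := by
    have hspec := Nat.find_spec hne
    rcases Nat.eq_zero_or_pos (Nat.find hne) with hz | hz
    · rw [hz] at hspec ⊢
      exact h0.resolve_left hspec
    · obtain ⟨k, hk⟩ : ∃ k, Nat.find hne = k + 1 := ⟨Nat.find hne - 1, by omega⟩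
      have hs := h k
      rw [← hk, hmin k (by omega)] at hs
      rcases hs with ⟨-, hs | hs⟩ | ⟨hs | hs, -⟩
      · exact absurd hs hspec
      · exact hs
      · exact absurd hs (by decide)
      · exact absurd hs (by decide)
  have h3 : ∀ k, φ (Nat.find hne + 1 + k) = 3 := by
    intro k
    induction k with
    | zero =>
      have hs := h (Nat.find hne)
      rw [h2] at hs
      rcases hs with ⟨hs, -⟩ | ⟨-, hs⟩
      · exact absurd hs (by decide)
      · exact hs
    | succ k ih =>
      have hs := h (Nat.find hne + 1 + k)
      rw [ih] at hs
      rcases hs with ⟨hs, -⟩ | ⟨-, hs⟩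
      · exact absurd hs (by decide)
      · exact hs
  refine ⟨Nat.find hne, fun t => ?_⟩
  split_ifs with hlt heq
  · exact hmin t hlt
  · rw [heq]; exact h2
  · have := h3 (t - (Nat.find hne + 1))
    rwa [show Nat.find hne + 1 + (t - (Nat.find hne + 1)) = t by omega] at this

theorem output_of_labelling (hT : T.IsDeterministic) {f : (ℕ → Sig) →. (ℕ → Gam)}
    (hf : T.Realizes f) {w : ℕ → Sig} {i : ℕ} {σ : ℕ → T.CellInfo L}
    (h : (T.pathSystem L).IsAccepting σ i) (hs : ∀ n, (σ n).sym = inputTape w n) :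
    ∃ y ∈ f w, y i = (σ 0).letter := by
  have hσ : ∀ n, CellEdge (σ n) (σ (n + 1)) := h.edge
  have ha : CellAcc σ := h.acc
  have hlab := isLabelling_of_edges hσ ha.ahead hs
  obtain ⟨ρ, γ, hrun, hinj, hv, hm, hph⟩ := exists_run_of_labelling hT hσ ha hs
  have hdom : w ∈ f.Dom := (hf.1 w).2 ⟨ρ, γ, hrun⟩
  refine ⟨_, Part.get_mem hdom, ?_⟩
  have hcat := hf.2 w ρ γ hrun _ (Part.get_mem hdom)
  obtain ⟨t₀, ht₀⟩ := phase_eq_of_phaseStep (φ := fun t => (σ (ρ t).2).phase (ρ t).1) hph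
    (by simpa [hrun.start] using (hσ 0).init (hs 0)) (by
      -- The run passes every cell, while phase `1` is absent from far cells; so the distinguished
      -- step does occur.
      obtain ⟨m, hm⟩ := eventually_atTop.1 ha.before
      obtain ⟨t, ht⟩ := hrun.readsAll m
      exact ⟨t, hm _ ht _⟩)
  obtain ⟨m, hm1, hm2⟩ := h.total
  obtain ⟨B, hB⟩ : ∃ B, ∀ t ≤ t₀, (ρ t).2 < B := by
    refine ⟨(Finset.range (t₀ + 1)).sup (fun t => (ρ t).2) + 1, fun t ht => Nat.lt_succ_of_le ?_⟩
    exact Finset.le_sup (f := fun t => (ρ t).2) (Finset.mem_range.2 (by omega))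
  -- The range of cells must cover both all cells of positive weight (`m`) and all cells seen up to
  -- the distinguished step (`B`).
  have hsum := sum_weight_eq hT hlab hinj hm (fun c => (hv c).1) ht₀ (m := max m B)
    (fun t ht => lt_max_of_lt_right (hB t ht))
  have hsum' : ∑ n ∈ Finset.range (max m B), (T.pathSystem L).weight (σ n) = i := by
    rw [← hm1]
    symm
    refine Finset.sum_subset (Finset.range_mono (le_max_left _ _)) fun n _ hn => hm2 n ?_
    simpa using hn
  rw [← hsum', hsum]
  apply hcat.apply_eq
  have h2 : (σ (ρ t₀).2).phase (ρ t₀).1 = 2 := by rw [ht₀]; simp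
  have hlet : ∀ n, (σ n).letter = (σ 0).letter := by
    intro n
    induction n with
    | zero => rfl
    | succ n ih => rw [(hσ n).letter, ih]
  rw [← hlet (ρ t₀).2]
  rcases hm t₀ with ⟨hact, _⟩ | ⟨hact, _⟩ <;> exact (hσ _).letter_off _ _ _ _ h2 hact

end TwoWayTransducer

/-! ### From accepting runs to accepting labellings -/

namespace TwoWayTransducer

variable {Sig Gam : Type*} {T : TwoWayTransducer Sig Gam} {L : ℕ}

/-- By determinism a repeated configuration would make the run periodic from there on, hence
confined to finitely many cells. -/
theorem IsAcceptingRun.injective (hT : T.IsDeterministic) {w : ℕ → Sig} {ρ : ℕ → T.State × ℕ}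
    {γ : ℕ → List Gam} (h : T.IsAcceptingRun w ρ γ) : Function.Injective ρ := by
  have key : ∀ k l, k < l → ρ k ≠ ρ l := by
    intro k l hkl heq
    have hper : ∀ j, ρ (k + j) = ρ (l + j) := by
      intro j
      induction j with
      | zero => exact heq
      | succ j ih =>
        have h1 := h.step (k + j)
        have h2 := h.step (l + j)
        rw [← ih] at h2
        exact (hT.step_unique h1 h2).2
    have hall : ∀ t, ∃ s < l, ρ t = ρ s := by
      intro t
      induction t using Nat.strong_induction_on with
      | _ t ih =>
        by_cases ht : t < l
        · exact ⟨t, ht, rfl⟩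
        · obtain ⟨s, hs, hs'⟩ := ih (k + (t - l)) (by omega)
          refine ⟨s, hs, ?_⟩
          rw [← hs', hper, show l + (t - l) = t by omega]
    obtain ⟨t, ht⟩ := h.readsAll ((Finset.range l).sup (fun t => (ρ t).2) + 1)
    obtain ⟨s, hs, hs'⟩ := hall t
    have := Finset.le_sup (f := fun t => (ρ t).2) (Finset.mem_range.2 hs)
    rw [hs'] at ht
    omega
  intro k l h
  by_contra hne
  rcases Nat.lt_or_gt_of_ne hne with h' | h'
  · exact key _ _ h' h
  · exact key _ _ h' h.symm

open Classical in
/-- The labelling of the tape of `w` obtained from a run and a distinguished step `t₀`. -/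
noncomputable def runLabelling (w : ℕ → Sig) (ρ : ℕ → T.State × ℕ) (t₀ : ℕ) (o : Fin L) (c : Gam)
    (n : ℕ) : T.CellInfo L where
  sym := inputTape w n
  letter := c
  ahead := {p | T.AheadHolds w n p}
  behind := T.behindState w n
  phase q := if h : ∃ t, ρ t = (q, n) then
    (if h.choose < t₀ then 1 else if h.choose = t₀ then 2 else 3) else 0
  fromLeft := {q | ∃ t, ρ (t + 1) = (q, n) ∧ (ρ t).2 + 1 = n}
  lt q q' := ∃ t t', t < t' ∧ ρ t = (q, n) ∧ ρ t' = (q', n)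
  off := o

section runLabelling

variable {w : ℕ → Sig} {ρ : ℕ → T.State × ℕ} {γ : ℕ → List Gam} {t₀ : ℕ} {o : Fin L} {c : Gam}

theorem isLabelling_runLabelling : IsLabelling w (runLabelling w ρ t₀ o c) :=
  ⟨fun _ => rfl, fun _ => rfl, fun _ => rfl⟩

theorem phase_runLabelling (hinj : Function.Injective ρ) (t : ℕ) :
    (runLabelling w ρ t₀ o c (ρ t).2).phase (ρ t).1 =
      if t < t₀ then 1 else if t = t₀ then 2 else 3 := by
  have h : ∃ s, ρ s = ((ρ t).1, (ρ t).2) := ⟨t, rfl⟩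
  have hc : h.choose = t := hinj h.choose_spec
  simp only [runLabelling, dif_pos h, hc]

theorem visited_runLabelling (hinj : Function.Injective ρ) (d : T.State × ℕ) :
    Visited (runLabelling w ρ t₀ o c) d ↔ ∃ t, ρ t = d := by
  constructor
  · intro h
    by_contra hn
    exact h (dif_neg hn)
  · rintro ⟨t, rfl⟩
    rw [Visited, phase_runLabelling hinj]
    split_ifs <;> decide

theorem phaseStep_runLabelling (hinj : Function.Injective ρ) (t : ℕ) :
    PhaseStep ((runLabelling w ρ t₀ o c (ρ t).2).phase (ρ t).1)
      ((runLabelling w ρ t₀ o c (ρ (t + 1)).2).phase (ρ (t + 1)).1) := by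
  rw [phase_runLabelling hinj, phase_runLabelling hinj]
  rcases lt_trichotomy t t₀ with h | h | h
  · rw [if_pos h]
    left
    refine ⟨rfl, ?_⟩
    by_cases h' : t + 1 < t₀
    · left; rw [if_pos h']
    · right; rw [if_neg h', if_pos (by omega)]
  · subst h
    right
    exact ⟨by simp, by simp⟩
  · right
    rw [if_neg (by omega), if_neg (by omega), if_neg (by omega), if_neg (by omega)]
    exact ⟨Or.inr rfl, rfl⟩

theorem move_runLabelling (hT : T.IsDeterministic) (hr : T.IsAcceptingRun w ρ γ) {t : ℕ}
    {g : List Gam} {d : T.State × ℕ} (h : Move (runLabelling w ρ t₀ o c) (ρ t) g d) :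
    g = γ t ∧ d = ρ (t + 1) :=
  hT.step_unique (isLabelling_runLabelling.move_iff.1 h) (hr.step t)

theorem edge_runLabelling (hT : T.IsDeterministic) (hr : T.IsAcceptingRun w ρ γ)
    (ho : (γ t₀)[(o : ℕ)]? = some c) (n : ℕ) :
    CellEdge (runLabelling w ρ t₀ o c n) (runLabelling w ρ t₀ o c (n + 1)) := by
  have hinj := hr.injective hT
  have hlab := isLabelling_runLabelling (w := w) (ρ := ρ) (t₀ := t₀) (o := o) (c := c)
  have hvis := fun q n => (visited_runLabelling (w := w) (t₀ := t₀) (o := o) (c := c) hinj (q, n)).1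
  have hvis' := fun d => (visited_runLabelling (w := w) (t₀ := t₀) (o := o) (c := c) hinj d).2
  have hmv : ∀ t, Move (runLabelling w ρ t₀ o c) (ρ t) (γ t) (ρ (t + 1)) :=
    fun t => hlab.move_iff.2 (hr.step t)
  have hmR : ∀ {t q q' n g}, ρ t = (q, n) →
      (runLabelling w ρ t₀ o c n).Act q (q', g, HeadDir.right) → ρ (t + 1) = (q', n + 1) := by
    intro t q q' n g ht ha
    refine (move_runLabelling (t₀ := t₀) (o := o) (c := c) hT hr (t := t) (g := g) (d := (q', n + 1)) ?_).2.symm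
    rw [ht]
    exact Or.inl ⟨ha, rfl⟩
  have hmL : ∀ {t q q' n g}, ρ t = (q, n + 1) →
      (runLabelling w ρ t₀ o c (n + 1)).Act q (q', g, HeadDir.left) → ρ (t + 1) = (q', n) := by
    intro t q q' n g ht ha
    refine (move_runLabelling (t₀ := t₀) (o := o) (c := c) hT hr (t := t) (g := g) (d := (q', n)) ?_).2.symm
    rw [ht]
    exact Or.inr ⟨ha, rfl⟩
  constructor
  · simp [runLabelling, inputTape]
  · rfl
  · ext p
    exact aheadHolds_iff w n p
  · exact behindState_succ w n
  · intro hs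
    cases n with
    | zero => simp [runLabelling, behindState, wordPrefix]
    | succ n => simp [runLabelling, inputTape] at hs
  · intro q hq
    obtain ⟨t, ht⟩ := hvis q n hq
    have := hmv t
    rw [ht] at this
    rcases this with ⟨h, _⟩ | ⟨h, _⟩ <;> exact ⟨_, h⟩
  · intro q q' g hs hq hact
    cases n with
    | succ n => simp [runLabelling, inputTape] at hs
    | zero =>
      obtain ⟨t, ht⟩ := hvis q 0 hq
      have := hmv t
      rw [ht] at this
      rcases this with ⟨h, _⟩ | ⟨h, h'⟩
      · simpa using hlab.act_unique hT h hact
      · simp at h'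
  · intro q q' g hq hact
    obtain ⟨t, ht⟩ := hvis q n hq
    have := phaseStep_runLabelling (w := w) (t₀ := t₀) (o := o) (c := c) hinj t
    rwa [hmR ht hact, ht] at this
  · intro q q' g hq hact
    obtain ⟨t, ht⟩ := hvis q (n + 1) hq
    have := phaseStep_runLabelling (w := w) (t₀ := t₀) (o := o) (c := c) hinj t
    rwa [hmL ht hact, ht] at this
  · intro hs
    cases n with
    | succ n => simp [runLabelling, inputTape] at hs
    | zero =>
      have := phase_runLabelling (w := w) (t₀ := t₀) (o := o) (c := c) hinj 0
      rw [hr.start] at this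
      simp only at this
      rw [this]
      by_cases h : 0 < t₀
      · left; rw [if_pos h]
      · right; rw [if_neg h, if_pos (by omega)]
  · rintro q ⟨t, ht, ht'⟩ -
    have hn : (ρ t).2 = n := by omega
    have := hmv t
    rw [ht] at this
    rcases this with ⟨h, _⟩ | ⟨_, h'⟩
    · rw [hn] at h
      refine ⟨(ρ t).1, γ t, ?_, h⟩
      have := hvis' (ρ t) ⟨t, rfl⟩
      rwa [Visited, hn] at this
    · simp only at h'
      omega
  · intro q hq hph hne
    obtain ⟨t, ht⟩ := hvis q n hph
    cases t with
    | zero =>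
      rw [hr.start] at ht
      simp only [Prod.mk.injEq] at ht
      exact absurd ⟨by simp [runLabelling, ← ht.2, inputTape], ht.1.symm⟩ hne
    | succ t =>
      have := hmv t
      rw [ht] at this
      rcases this with ⟨_, h'⟩ | ⟨h, h'⟩
      · exact absurd ⟨t, ht, h'.symm⟩ hq
      · simp only at h h'
        rw [h'] at h
        refine ⟨(ρ t).1, γ t, ?_, h⟩
        have := hvis' (ρ t) ⟨t, rfl⟩
        rwa [Visited, h'] at this
  · intro hs
    cases n with
    | succ n => simp [runLabelling, inputTape] at hs
    | zero => simp [runLabelling]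
  · rintro q ⟨t, t', hlt, h, h'⟩
    have := hinj (h.trans h'.symm)
    omega
  · rintro q q' q'' ⟨t, t', hlt, h, h'⟩ ⟨s, s', hlt', k, k'⟩
    have := hinj (h'.trans k.symm)
    exact ⟨t, s', by omega, h, k'⟩
  · intro q₁ q₂ q₃ q₄ g g' h1 h2 h3 h4 hact hact' hor
    obtain ⟨t, ht⟩ := hvis _ _ h1
    obtain ⟨t', ht'⟩ := hvis _ _ h3
    have e := hmR ht hact
    have e' := hmL ht' hact'
    refine ⟨t, t' + 1, ?_, ht, e'⟩
    rcases hor with rfl | ⟨s, s', hlt, hs, hs'⟩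
    · have := hinj (e.trans ht'.symm)
      omega
    · have h5 := hinj (e.trans hs.symm)
      have h6 := hinj (ht'.trans hs'.symm)
      omega
  · intro q₁ q₂ q₃ q₄ g g' h1 h2 h3 h4 hact hact' hor
    obtain ⟨t, ht⟩ := hvis _ _ h1
    obtain ⟨t', ht'⟩ := hvis _ _ h3
    have e := hmL ht hact
    have e' := hmR ht' hact'
    refine ⟨t, t' + 1, ?_, ht, e'⟩
    rcases hor with rfl | ⟨s, s', hlt, hs, hs'⟩
    · have := hinj (e.trans ht'.symm)
      omega
    · have h5 := hinj (e.trans hs.symm)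
      have h6 := hinj (ht'.trans hs'.symm)
      omega
  · intro q q' g d hph hact
    obtain ⟨t, ht⟩ := hvis q n (by rw [Visited, hph]; decide)
    have hpt := phase_runLabelling (w := w) (t₀ := t₀) (o := o) (c := c) hinj t
    simp only [ht] at hpt
    rw [hph] at hpt
    have htt : t = t₀ := by
      by_contra hne
      split_ifs at hpt <;> exact absurd hpt (by decide)
    subst htt
    have hm := hmv t
    have hg : g = γ t := by
      rw [ht] at hm
      rcases hm with ⟨h, _⟩ | ⟨h, _⟩
      · exact (Prod.mk.inj (Prod.mk.inj (hlab.act_unique hT hact h)).2).1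
      · exact (Prod.mk.inj (Prod.mk.inj (hlab.act_unique hT hact h)).2).1
    rw [hg]
    exact ho

theorem acc_runLabelling (hT : T.IsDeterministic) (hr : T.IsAcceptingRun w ρ γ) :
    CellAcc (runLabelling w ρ t₀ o c) := by
  have hinj := hr.injective hT
  refine ⟨?_, ⟨0, fun n _ => rfl⟩, ?_, ?_⟩
  · rintro ⟨d, hd⟩
    -- Along a backward chain of visited configurations the time drops by one at each link, which
    -- cannot go on forever.
    have key : ∀ t k, ρ t ≠ d k := by
      intro t
      induction t with
      | zero =>
        intro k hk
        obtain ⟨g, hm⟩ := (hd k).2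
        obtain ⟨s, hs⟩ := (visited_runLabelling hinj _).1 (hd (k + 1)).1
        rw [← hs] at hm
        have := (move_runLabelling hT hr hm).2
        rw [← hk] at this
        have := hinj this
        omega
      | succ t ih =>
        intro k hk
        obtain ⟨g, hm⟩ := (hd k).2
        obtain ⟨s, hs⟩ := (visited_runLabelling hinj _).1 (hd (k + 1)).1
        rw [← hs] at hm
        have := (move_runLabelling hT hr hm).2
        rw [← hk] at this
        have hst := hinj this
        obtain rfl : t = s := by omega
        exact ih _ hs
    obtain ⟨s, hs⟩ := (visited_runLabelling hinj _).1 (hd 0).1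
    exact key s 0 hs
  · rw [← infSet_run_eq hinj (visited_runLabelling hinj)]
    exact hr.muller
  · rw [eventually_atTop]
    refine ⟨(Finset.range t₀).sup (fun t => (ρ t).2) + 1, fun n hn q hph => ?_⟩
    obtain ⟨t, ht⟩ := (visited_runLabelling (w := w) (t₀ := t₀) (o := o) (c := c) hinj (q, n)).1
      (by rw [Visited, hph]; decide)
    have hpt := phase_runLabelling (w := w) (t₀ := t₀) (o := o) (c := c) hinj t
    simp only [ht] at hpt
    rw [hph] at hpt
    have htt : t < t₀ := by
      by_contra hne
      split_ifs at hpt <;> exact absurd hpt (by decide)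
    have := Finset.le_sup (f := fun t => (ρ t).2) (Finset.mem_range.2 htt)
    rw [ht] at this
    simp only at this
    omega

end runLabelling

/-- The bound confines the offset of the distinguished letter to `Fin L`, which keeps the vertex
type finite. -/
theorem exists_output_bound [Finite Sig] (T : TwoWayTransducer Sig Gam) :
    ∃ L, ∀ q a p b r, T.trans q a p b = some r → r.2.1.length ≤ L := by
  have := T.finState
  have := T.finAhead
  have := T.finBehind
  obtain ⟨L, hL⟩ := (Set.finite_range
    fun z : T.State × Option Sig × T.Ahead × T.Behind =>
      ((T.trans z.1 z.2.1 z.2.2.1 z.2.2.2).map fun r => r.2.1.length).getD 0).bddAbove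
  refine ⟨L, fun q a p b r h => hL ⟨(q, a, p, b), ?_⟩⟩
  simp [h]

theorem Realizes.describes {f : (ℕ → Sig) →. (ℕ → Gam)} (hT : T.IsDeterministic)
    (hf : T.Realizes f) (hL : ∀ q a p b r, T.trans q a p b = some r → r.2.1.length ≤ L) :
    (T.pathSystem L).Describes f := by
  intro w i c
  constructor
  · rintro ⟨y, hy, rfl⟩
    obtain ⟨ρ, γ, hr⟩ := (hf.1 w).1 (Part.dom_iff_mem.2 ⟨y, hy⟩)
    have hinj := hr.injective hT
    obtain ⟨t₀, o, hi, ho⟩ := (hf.2 w ρ γ hr y hy).exists_index i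
    have hoL : o < L := by
      have h1 : o < (γ t₀).length := (List.getElem?_eq_some_iff.1 ho).1
      obtain ⟨p, _, ⟨h, _⟩ | ⟨h, _⟩⟩ := hr.step t₀
      · exact h1.trans_le (hL _ _ _ _ _ h)
      · exact h1.trans_le (hL _ _ _ _ _ h)
    refine ⟨runLabelling w ρ t₀ ⟨o, hoL⟩ (y i), ⟨edge_runLabelling hT hr ho,
      acc_runLabelling hT hr, ?_⟩, fun n => rfl, rfl⟩
    have hlab := isLabelling_runLabelling (w := w) (ρ := ρ) (t₀ := t₀) (o := ⟨o, hoL⟩) (c := y i)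
    have hsum := fun m hb => sum_weight_eq hT hlab hinj (fun t => hlab.move_iff.2 (hr.step t))
      (fun d => (visited_runLabelling hinj d).1) (phase_runLabelling hinj) (m := m) hb
    obtain ⟨B, hB⟩ : ∃ B, ∀ t ≤ t₀, (ρ t).2 < B := by
      refine ⟨(Finset.range (t₀ + 1)).sup (fun t => (ρ t).2) + 1,
        fun t ht => Nat.lt_succ_of_le ?_⟩
      exact Finset.le_sup (f := fun t => (ρ t).2) (Finset.mem_range.2 (by omega))
    refine ⟨B, (hsum B hB).trans hi, fun n hn => ?_⟩
    -- The partial sums up to `n` and up to `n + 1` have the same value, so cell `n` has weight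
    -- zero.
    have h1 := hsum n (fun t ht => (hB t ht).trans_le hn)
    have h2 := hsum (n + 1) (fun t ht => (hB t ht).trans_le (by omega))
    rw [Finset.sum_range_succ, h1] at h2
    omega
  · rintro ⟨σ, h, hs, rfl⟩
    exact output_of_labelling hT hf h hs

end TwoWayTransducer

/-- From here on the transducer is no longer needed. Vertices are renumbered by `Fin K` so that they
can be handled by primitive recursive functions. -/
theorem IsRegularFunction.exists_describes {Sig Gam : Type*} [Finite Sig] [Finite Gam]
    {f : (ℕ → Sig) →. (ℕ → Gam)} (hf : IsRegularFunction f) :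
    ∃ (K : ℕ) (N : PathSystem Sig Gam (Fin K)), N.Describes f := by
  obtain ⟨T, hT, hf⟩ := hf
  obtain ⟨L, hL⟩ := T.exists_output_bound
  exact ⟨_, _, (hf.describes hT hL).map (Finite.equivFin _)⟩

namespace PathSystem

variable {Sig Gam S : Type*} (N : PathSystem Sig Gam S)

/-! ### Accepting paths with a given total weight -/

/-- Some accepting path from `s` has total weight `i`. -/
def Total (s : S) (i : ℕ) : Prop :=
  ∃ ρ, ρ 0 = s ∧ N.IsAccepting ρ i

variable {N}

theorem HasTotal.cons {ρ : ℕ → S} {i : ℕ} (h : N.HasTotal (fun n => ρ (n + 1)) i) :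
    N.HasTotal ρ (N.weight (ρ 0) + i) := by
  obtain ⟨m, h1, h2⟩ := h
  refine ⟨m + 1, ?_, fun n hn => ?_⟩
  · rw [Finset.sum_range_succ', h1, add_comm]
  · obtain ⟨n, rfl⟩ : ∃ k, n = k + 1 := ⟨n - 1, by omega⟩
    exact h2 n (by omega)

theorem HasTotal.exists_tail {ρ : ℕ → S} {i : ℕ} (h : N.HasTotal ρ i) :
    ∃ d, N.HasTotal (fun n => ρ (n + 1)) d ∧ N.weight (ρ 0) + d = i := by
  obtain ⟨m, h1, h2⟩ := h
  refine ⟨∑ n ∈ Finset.range m, N.weight (ρ (n + 1)), ⟨m, rfl, fun n hn => h2 _ (by omega)⟩, ?_⟩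
  rw [add_comm, ← Finset.sum_range_succ' (fun n => N.weight (ρ n)), Finset.sum_range_succ, h1,
    h2 m le_rfl, add_zero]

theorem IsAccepting.exists_tail {ρ : ℕ → S} {i : ℕ} (h : N.IsAccepting ρ i) :
    ∃ d, N.IsAccepting (fun n => ρ (n + 1)) d ∧ N.weight (ρ 0) + d = i := by
  obtain ⟨d, h1, h2⟩ := h.total.exists_tail
  exact ⟨d, ⟨fun n => h.edge (n + 1), (N.acc_tail ρ h.edge).2 h.acc, h1⟩, h2⟩

theorem IsAccepting.cons {ρ : ℕ → S} {i : ℕ} (h : N.IsAccepting (fun n => ρ (n + 1)) i)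
    (he : N.edge (ρ 0) (ρ 1)) : N.IsAccepting ρ (N.weight (ρ 0) + i) := by
  have hedge : ∀ n, N.edge (ρ n) (ρ (n + 1)) := by
    rintro (_ | n)
    · exact he
    · exact h.edge n
  exact ⟨hedge, (N.acc_tail ρ hedge).1 h.acc, h.total.cons⟩

theorem Total.cons {s s' : S} {i : ℕ} (h : N.Total s' i) (he : N.edge s s') :
    N.Total s (N.weight s + i) := by
  obtain ⟨ρ, rfl, h⟩ := h
  exact ⟨fun n => Nat.casesOn n s ρ, rfl, IsAccepting.cons (ρ := fun n : ℕ => (Nat.casesOn n s ρ : S)) h he⟩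

/-- The path is cut after its first vertex of positive weight. What remains has a strictly smaller
total, which gives a recursion on the weight. -/
theorem total_pos_iff {s : S} {i : ℕ} (hi : 0 < i) :
    N.Total s i ↔ ∃ t t' d, Relation.ReflTransGen (fun a b => N.edge a b ∧ N.weight a = 0) s t ∧
      N.edge t t' ∧ 0 < N.weight t ∧ N.Total t' d ∧ N.weight t + d = i := by
  constructor
  · rintro ⟨ρ, rfl, h⟩
    obtain ⟨m, hm⟩ := h.total
    induction m generalizing ρ with
    | zero => simp at hm; omega
    | succ m ih =>
      obtain ⟨d, hd, hdi⟩ := h.exists_tail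
      by_cases hw : N.weight (ρ 0) = 0
      · obtain rfl : d = i := by omega
        obtain ⟨t, t', d', h1, h2⟩ := ih _ hd ⟨by
          have := hm.1
          rwa [Finset.sum_range_succ', hw, add_zero] at this, fun n hn => hm.2 _ (by omega)⟩
        exact ⟨t, t', d', Relation.ReflTransGen.head ⟨h.edge 0, hw⟩ h1, h2⟩
      · exact ⟨ρ 0, ρ 1, d, Relation.ReflTransGen.refl, h.edge 0, Nat.pos_of_ne_zero hw,
          ⟨_, rfl, hd⟩, hdi⟩
  · rintro ⟨t, t', d, h1, h2, -, h4, rfl⟩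
    induction h1 using Relation.ReflTransGen.head_induction_on with
    | refl => exact h4.cons h2
    | head h _ ih =>
      have := ih.cons h.1
      rwa [h.2, zero_add] at this

/-- The sets of vertices from which a given total weight is possible are generated by a finite
deterministic automaton that reads the weight in unary. -/
theorem exists_unary_automaton [Finite S] (N : PathSystem Sig Gam S) :
    ∃ (k : ℕ) (x₀ : Fin k) (G : Fin k → Fin k) (A : Fin k → Set S),
      ∀ n s, s ∈ A (G^[n] x₀) ↔ N.Total s n := by
  obtain ⟨W, hW⟩ := (Set.finite_range N.weight).bddAbove
  have hW : ∀ s, N.weight s ≤ W := fun s => hW ⟨s, rfl⟩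
  -- A state is a shift register: after `n` steps, component `k` holds the vertices with possible
  -- total `n - k`, and is empty if `k > n`. By `total_pos_iff` the new component `0` depends only
  -- on the previous `W` totals, as weights are at most `W`.
  let X := Fin (W + 1) → Set S
  let x₀ : X := fun k => {s | (k : ℕ) = 0 ∧ N.Total s 0}
  let G : X → X := fun x k => {s | ((k : ℕ) = 0 ∧ ∃ t t' k',
      Relation.ReflTransGen (fun a b => N.edge a b ∧ N.weight a = 0) s t ∧ N.edge t t' ∧
      N.weight t = (k' : Fin (W + 1)).1 + 1 ∧ t' ∈ x k') ∨
    ∃ k' : Fin (W + 1), (k : ℕ) = k'.1 + 1 ∧ s ∈ x k'}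
  have key : ∀ n k s, s ∈ (G^[n] x₀) k ↔ ∃ d, N.Total s d ∧ d + (k : ℕ) = n := by
    intro n
    induction n with
    | zero =>
      intro k s
      simp only [Function.iterate_zero, id, x₀]
      constructor
      · rintro ⟨h, h'⟩
        exact ⟨0, h', by omega⟩
      · rintro ⟨d, h, h'⟩
        obtain rfl : d = 0 := by omega
        exact ⟨by omega, h⟩
    | succ n ih =>
      intro k s
      rw [Function.iterate_succ_apply']
      simp only [G, ih, Set.mem_ofPred_eq]
      constructor
      · rintro (⟨hk, t, t', k', h1, h2, h3, d, h4, h5⟩ | ⟨k', hk, d, h4, h5⟩)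
        · exact ⟨n + 1, (total_pos_iff (Nat.succ_pos n)).2
            ⟨t, t', d, h1, h2, by omega, h4, by omega⟩, by omega⟩
        · exact ⟨d, h4, by omega⟩
      · rintro ⟨d, h, hd⟩
        by_cases hk : (k : ℕ) = 0
        · left
          obtain rfl : d = n + 1 := by omega
          obtain ⟨t, t', d, h1, h2, h3, h4, h5⟩ := (total_pos_iff (Nat.succ_pos n)).1 h
          have := hW t
          exact ⟨hk, t, t', ⟨N.weight t - 1, by omega⟩, h1, h2, by simp; omega, d, h4,
            by simp; omega⟩
        · right
          exact ⟨⟨k - 1, by omega⟩, by simp; omega, d, h, by simp; omega⟩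
  have e := Finite.equivFin X
  refine ⟨_, e x₀, fun k => e (G (e.symm k)), fun k => e.symm k 0, fun n s => ?_⟩
  have hsc : Function.Semiconj e G (fun k => e (G (e.symm k))) := fun x => by simp
  rw [← (hsc.iterate_right n).eq]
  simp [key]

/-! ### Vertices reached by a finite word -/

variable (N)

/-- The vertices, with the weight collected before, that are reached after one more letter. -/
def reachStep (R : Set (S × ℕ)) (a : Sig) : Set (S × ℕ) :=
  {z | ∃ s j, (s, j) ∈ R ∧ N.edge s z.1 ∧ N.sym z.1 = some a ∧ z.2 = j + N.weight s}

/-- The vertices reached by paths over the tape content `⊢ u`, with the weight collected before. -/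
def reach (u : List Sig) : Set (S × ℕ) :=
  u.foldl N.reachStep {z | N.sym z.1 = none ∧ z.2 = 0}

theorem reach_append (u : List Sig) (a : Sig) : N.reach (u ++ [a]) = N.reachStep (N.reach u) a := by
  simp [reach]

/-- Some word that extends `u` has an accepting path with letter `c` and total weight `i`. -/
def Possible (u : List Sig) (i : ℕ) (c : Gam) : Prop :=
  ∃ s j, (s, j) ∈ N.reach u ∧ N.letter s = c ∧ ∃ d, N.Total s d ∧ j + d = i

variable {N}

/-- A finite path over `u` can be glued to any accepting path from its end point, since acceptance
is insensitive to finite prefixes and weights add. The weight of `s` is counted in `d`, not in `j`.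
-/
theorem exists_path_of_mem_reach (u : List Sig) : ∀ {s : S} {j : ℕ} {ρ : ℕ → S} {d : ℕ},
    (s, j) ∈ N.reach u → ρ 0 = s → N.IsAccepting ρ d →
    ∃ ρ', N.IsAccepting ρ' (j + d) ∧ N.sym (ρ' 0) = none ∧
      (∀ k < u.length, N.sym (ρ' (k + 1)) = u[k]?) ∧ ∀ n, ρ' (u.length + n) = ρ n := by
  induction u using List.reverseRecOn with
  | nil =>
    rintro s j ρ d ⟨h1, h2⟩ rfl h
    simp only at h1 h2
    exact ⟨ρ, by simpa [h2] using h, h1, by simp, by simp⟩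
  | append_singleton u a ih =>
    rintro s' j' ρ d hs rfl h
    rw [reach_append] at hs
    obtain ⟨s, j, hs, he, hsym, hj⟩ := hs
    simp only at he hsym hj
    obtain ⟨ρ', h1, h2, h3, h4⟩ := ih (ρ := fun n : ℕ => (Nat.casesOn n s ρ : S)) hs rfl
      (IsAccepting.cons (ρ := fun n : ℕ => (Nat.casesOn n s ρ : S)) h he)
    refine ⟨ρ', by rw [hj, add_assoc]; exact h1, h2, fun k hk => ?_, fun n => ?_⟩
    · by_cases hk' : k < u.length
      · rw [h3 k hk', List.getElem?_append_left hk']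
      · obtain rfl : k = u.length := by simp at hk; omega
        rw [h4 1]
        simpa using hsym
    · have := h4 (n + 1)
      rw [List.length_append, List.length_singleton, add_assoc, add_comm 1 n, this]

theorem letter_eq_letter_zero {ρ : ℕ → S} (h : ∀ n, N.edge (ρ n) (ρ (n + 1))) (n : ℕ) :
    N.letter (ρ n) = N.letter (ρ 0) := by
  induction n with
  | zero => rfl
  | succ n ih => rw [N.edge_letter _ _ (h n), ih]

theorem mem_reach_of_path {x : ℕ → Sig} {ρ : ℕ → S} {i : ℕ} (h : N.IsAccepting ρ i)
    (hs : ∀ n, N.sym (ρ n) = inputTape x n) (k : ℕ) :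
    ∃ j d, (ρ k, j) ∈ N.reach (wordPrefix x k) ∧ N.IsAccepting (fun n => ρ (k + n)) d ∧
      j + d = i := by
  induction k with
  | zero =>
    refine ⟨0, i, ?_, by simpa using h, by simp⟩
    simp [wordPrefix, reach, hs, inputTape]
  | succ k ih =>
    obtain ⟨j, d, h1, h2, h3⟩ := ih
    obtain ⟨d', h4, h5⟩ := h2.exists_tail
    refine ⟨j + N.weight (ρ k), d', ?_, ?_, by simp at h5; omega⟩
    · rw [wordPrefix_succ, reach_append]
      exact ⟨ρ k, j, h1, h.edge k, hs (k + 1), rfl⟩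
    · simpa [add_assoc, add_comm 1] using h4

theorem Describes.possible_iff {f : (ℕ → Sig) →. (ℕ → Gam)} (hf : N.Describes f) {u : List Sig}
    {i : ℕ} {c : Gam} :
    N.Possible u i c ↔ ∃ x, ∃ y ∈ f x, u = wordPrefix x u.length ∧ y i = c := by
  constructor
  · rintro ⟨s, j, hs, rfl, d, ⟨ρ, rfl, hρ⟩, rfl⟩
    obtain ⟨ρ', h1, h2, h3, h4⟩ := exists_path_of_mem_reach u hs rfl hρ
    -- No edge leads to the delimiter, so the glued path is over the tape of an actual infinite
    -- word.
    have hx : ∀ n, ∃ a, N.sym (ρ' (n + 1)) = some a := fun n =>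
      Option.ne_none_iff_exists'.1 (N.edge_sym _ _ (h1.edge n))
    choose x hx using hx
    obtain ⟨y, hy, hyi⟩ := (hf x (j + d) (N.letter (ρ' 0))).2 ⟨ρ', h1, by
      rintro (_ | n)
      · exact h2
      · exact hx n, rfl⟩
    refine ⟨x, y, hy, ?_, ?_⟩
    · refine List.ext_getElem? fun k => ?_
      by_cases hk : k < u.length
      · rw [← h3 k hk, hx, getElem?_wordPrefix _ hk]
      · rw [List.getElem?_eq_none (by omega), List.getElem?_eq_none (by simp; omega)]
    · rw [hyi, ← letter_eq_letter_zero h1.edge u.length, ← h4 0, add_zero]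
  · rintro ⟨x, y, hy, hu, rfl⟩
    obtain ⟨ρ, h1, h2, h3⟩ := (hf x i (y i)).1 ⟨y, hy, rfl⟩
    obtain ⟨j, d, h4, h5, h6⟩ := mem_reach_of_path h1 h2 u.length
    rw [← hu] at h4
    exact ⟨_, j, h4, by rw [letter_eq_letter_zero h1.edge, h3], d, ⟨_, by simp, h5⟩, h6⟩

end PathSystem

/-! ### The mismatch problem -/

namespace PathSystem

variable {Sig Gam : Type*}

open Classical in
/-- The vertices reached by a finite word, as a list. -/
noncomputable def reachList {K n : ℕ} (N : PathSystem Sig Gam (Fin K)) (e : Fin n ≃ Sig)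
    (u : List (Fin n)) : List (Fin K × ℕ) :=
  u.foldl (fun l a => l.flatMap fun z =>
      ((List.finRange K).filter fun s => N.edge z.1 s ∧ N.sym s = some (e a)).map
        fun s => (s, z.2 + N.weight z.1))
    (((List.finRange K).filter fun s => N.sym s = none).map fun s => (s, 0))

theorem mem_reachList {K n : ℕ} (N : PathSystem Sig Gam (Fin K)) (e : Fin n ≃ Sig)
    (u : List (Fin n)) (z : Fin K × ℕ) : z ∈ N.reachList e u ↔ z ∈ N.reach (u.map e) := by
  induction u using List.reverseRecOn generalizing z with
  | nil =>
    obtain ⟨s, j⟩ := z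
    simp [reachList, reach, eq_comm]
  | append_singleton u a ih =>
    rw [List.map_append, List.map_singleton, reach_append, reachList, List.foldl_append]
    change z ∈ (N.reachList e u).flatMap _ ↔ _
    obtain ⟨s', j'⟩ := z
    simp only [List.mem_flatMap, ih, reachStep, Set.mem_ofPred_eq, List.mem_map, List.mem_filter,
      List.mem_finRange, true_and, decide_eq_true_eq, Prod.mk.injEq]
    constructor
    · rintro ⟨⟨s, j⟩, h, t, ⟨h1, h2⟩, rfl, rfl⟩
      exact ⟨s, j, h, h1, h2, rfl⟩
    · rintro ⟨s, j, h, h1, h2, rfl⟩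
      exact ⟨(s, j), h, s', ⟨h1, h2⟩, rfl, rfl⟩

theorem primrec_reachList {K n : ℕ} (N : PathSystem Sig Gam (Fin K)) (e : Fin n ≃ Sig) :
    Primrec (N.reachList e) := by
  classical
  refine Primrec.list_foldl
    (h := fun _ (p : List (Fin K × ℕ) × Fin n) => p.1.flatMap fun z =>
      ((List.finRange K).filter fun s => N.edge z.1 s ∧ N.sym s = some (e p.2)).map
        fun s => (s, z.2 + N.weight z.1))
    Primrec.id (Primrec.const _) ?_
  refine Primrec.list_flatMap (Primrec.fst.comp Primrec.snd) ?_
  refine Primrec.list_map ?_ ?_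
  · exact (Primrec.dom_finite fun q : Fin K × Fin n =>
      (List.finRange K).filter fun s => N.edge q.1 s ∧ N.sym s = some (e q.2)).comp
        (Primrec.pair (Primrec.fst.comp Primrec.snd)
          (Primrec.snd.comp (Primrec.snd.comp Primrec.fst)))
  · refine Primrec.pair Primrec.snd (Primrec.nat_add.comp ?_ ?_)
    · exact Primrec.snd.comp (Primrec.snd.comp Primrec.fst)
    · exact (Primrec.dom_finite N.weight).comp (Primrec.fst.comp (Primrec.snd.comp Primrec.fst))

/-- Both quantifiers on the right range over finite sets, and the weight still missing at a reached
vertex is a number known to the algorithm. -/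
theorem Describes.hasMismatch_iff {S : Type*} {N : PathSystem Sig Gam S}
    {f : (ℕ → Sig) →. (ℕ → Gam)} (hf : N.Describes f) (u : List Sig) (v : List Gam) :
    HasMismatch f u v ↔ ∃ z ∈ N.reach u, ∃ i < v.length,
      z.2 ≤ i ∧ N.Total z.1 (i - z.2) ∧ v[i]? ≠ some (N.letter z.1) := by
  constructor
  · rintro ⟨x, y, hy, hu, i, hi, hne⟩
    obtain ⟨s, j, h1, h2, d, h3, rfl⟩ := hf.possible_iff.2 ⟨x, y, hy, hu, rfl (a := y i)⟩
    refine ⟨(s, j), h1, j + d, hi, by simp, by simpa using h3, ?_⟩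
    rw [List.getElem?_eq_getElem hi, h2]
    simpa using hne
  · rintro ⟨⟨s, j⟩, h1, i, hi, hj, h2, h3⟩
    simp only at hj h2 h3
    obtain ⟨x, y, hy, hu, hyi⟩ := hf.possible_iff.1 ⟨s, j, h1, rfl, i - j, h2, Nat.add_sub_cancel' hj⟩
    refine ⟨x, y, hy, hu, i, hi, ?_⟩
    rw [hyi]
    rw [List.getElem?_eq_getElem hi] at h3
    simpa using h3

theorem Describes.mismatchDecidable {K : ℕ} {N : PathSystem Sig Gam (Fin K)}
    {f : (ℕ → Sig) →. (ℕ → Gam)} (hf : N.Describes f) : MismatchDecidable f := by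
  classical
  intro n m e e'
  obtain ⟨k, x₀, G, A, hA⟩ := N.exists_unary_automaton
  -- The edge data, `G` and `A` are finite tables, so they enter as primitive recursive constants.
  -- The guard `p.1.2 ≤ i` makes the truncated subtraction harmless.
  have hR : PrimrecRel fun (i : ℕ) (p : (Fin K × ℕ) × List (Fin m)) =>
      p.1.2 ≤ i ∧ p.1.1 ∈ A (G^[i - p.1.2] x₀) ∧ ¬ p.2[i]? = some (e'.symm (N.letter p.1.1)) := by
    refine PrimrecPred.and ?_ (PrimrecPred.and ?_ (PrimrecPred.not ?_))
    · exact Primrec.nat_le.comp (Primrec.snd.comp (Primrec.fst.comp Primrec.snd)) Primrec.fst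
    · have h1 : PrimrecPred fun q : Fin K × Fin k => q.1 ∈ A q.2 :=
        ⟨inferInstance, Primrec.dom_finite _⟩
      refine h1.comp (f := fun p : ℕ × (Fin K × ℕ) × List (Fin m) =>
        (p.2.1.1, G^[p.1 - p.2.1.2] x₀)) (Primrec.pair ?_ ?_)
      · exact Primrec.fst.comp (Primrec.fst.comp Primrec.snd)
      · refine Primrec.nat_iterate (h := fun _ => G) ?_ (Primrec.const _)
          ((Primrec.dom_finite G).comp Primrec.snd).to₂
        exact Primrec.nat_sub.comp Primrec.fst
          (Primrec.snd.comp (Primrec.fst.comp Primrec.snd))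
    · refine Primrec.eq.comp ?_ ?_
      · exact Primrec.list_getElem?.comp (Primrec.snd.comp Primrec.snd) Primrec.fst
      · exact (Primrec.dom_finite fun s => some (e'.symm (N.letter s))).comp
          (Primrec.fst.comp (Primrec.fst.comp Primrec.snd))
  have hR2 : PrimrecRel fun (z : Fin K × ℕ) (v : List (Fin m)) =>
      ∃ i ∈ List.range v.length,
        z.2 ≤ i ∧ z.1 ∈ A (G^[i - z.2] x₀) ∧ ¬ v[i]? = some (e'.symm (N.letter z.1)) :=
    hR.exists_mem_list.comp (f := fun p : (Fin K × ℕ) × List (Fin m) => List.range p.2.length)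
      (g := id) (Primrec.list_range.comp (Primrec.list_length.comp Primrec.snd)) Primrec.id
  have hR3 := hR2.exists_mem_list.comp
    (f := fun p : List (Fin n) × List (Fin m) => N.reachList e p.1) (g := Prod.snd)
    ((N.primrec_reachList e).comp Primrec.fst) Primrec.snd
  obtain ⟨hdec, hprim⟩ := hR3.of_eq (q := fun p : List (Fin n) × List (Fin m) =>
      HasMismatch f (p.1.map e) (p.2.map e')) (by
    rintro ⟨u, v⟩
    rw [hf.hasMismatch_iff]
    simp only [mem_reachList, List.mem_range, hA, List.length_map, List.getElem?_map, ne_eq]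
    refine exists_congr fun z => and_congr_right fun _ => exists_congr fun i =>
      and_congr_right fun _ => and_congr_right fun _ => and_congr_right fun _ => not_congr ?_
    cases v[i]? with
    | none => simp
    | some b => simp [Equiv.eq_symm_apply])
  exact ⟨hdec, hprim.to_comp⟩

end PathSystem

/-! ### Continuity -/

theorem continuous_asSubtype_iff {Sig Gam : Type*} [TopologicalSpace Sig] [DiscreteTopology Sig]
    [TopologicalSpace Gam] [DiscreteTopology Gam] (f : (ℕ → Sig) →. (ℕ → Gam)) :
    Continuous f.asSubtype ↔ ∀ x, ∀ y ∈ f x, ∀ i, ∃ k, ∀ x', ∀ y' ∈ f x',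
      (∀ j < k, x' j = x j) → y' i = y i := by
  constructor
  · intro hc x y hy i
    have hx : x ∈ f.Dom := Part.dom_iff_mem.2 ⟨y, hy⟩
    have hopen : IsOpen ((fun z : f.Dom => f.asSubtype z i) ⁻¹' {y i}) :=
      (isOpen_discrete _).preimage ((continuous_apply i).comp hc)
    obtain ⟨U, hU, hUe⟩ := isOpen_induced_iff.1 hopen
    have hxU : x ∈ U := by
      have : (⟨x, hx⟩ : f.Dom) ∈ Subtype.val ⁻¹' U := by
        rw [hUe]
        simp [PFun.asSubtype_eq_of_mem hy hx]
      exact this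
    obtain ⟨I, u, h1, h2⟩ := isOpen_pi_iff.1 hU x hxU
    refine ⟨I.sup id + 1, fun x' y' hy' hj => ?_⟩
    have hx' : x' ∈ f.Dom := Part.dom_iff_mem.2 ⟨y', hy'⟩
    have hmem : x' ∈ U := h2 fun a ha => by
      rw [hj a (Nat.lt_succ_of_le (Finset.le_sup (f := id) ha))]
      exact (h1 a ha).2
    have : (⟨x', hx'⟩ : f.Dom) ∈ Subtype.val ⁻¹' U := hmem
    rw [hUe] at this
    simpa [PFun.asSubtype_eq_of_mem hy' hx'] using this
  · intro h
    refine continuous_pi fun i => ?_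
    rw [continuous_discrete_rng]
    intro c
    rw [isOpen_iff_mem_nhds]
    rintro ⟨x, hx⟩ hxc
    obtain ⟨y, hy⟩ := Part.dom_iff_mem.1 hx
    obtain ⟨k, hk⟩ := h x y hy i
    have hyc : y i = c := by simpa [PFun.asSubtype_eq_of_mem hy hx] using hxc
    have hopen : IsOpen {x' : ℕ → Sig | ∀ j < k, x' j = x j} := by
      have : {x' : ℕ → Sig | ∀ j < k, x' j = x j} = Set.pi (Set.Iio k) fun j => {x j} := by
        ext; simp [Set.mem_pi]
      rw [this]
      exact isOpen_set_pi (Set.finite_lt_nat k) fun j _ => isOpen_discrete _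
    refine Filter.mem_of_superset
      ((hopen.preimage continuous_subtype_val).mem_nhds (x := ⟨x, hx⟩) (by simp)) ?_
    rintro ⟨x', hx'⟩ hmem
    obtain ⟨y', hy'⟩ := Part.dom_iff_mem.1 hx'
    have := hk x' y' hy' hmem
    simp [PFun.asSubtype_eq_of_mem hy' hx', this, hyc]

/-! ### Computable functions are continuous -/

namespace StreamMachine

variable {Sig Gam : Type*} (M : StreamMachine Sig Gam)

theorem configAt_succ (x : ℕ → Sig) (n : ℕ) :
    M.configAt x (n + 1) = M.step x (M.configAt x n) :=
  Function.iterate_succ_apply' _ _ _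

theorem inPos_step (x : ℕ → Sig) (c : M.Config) :
    (M.step x c).inPos = c.inPos ∨ (M.step x c).inPos = c.inPos + 1 := by
  unfold step
  split
  · exact Or.inl rfl
  · simp only
    split_ifs
    · exact Or.inr rfl
    · exact Or.inl rfl

theorem output_prefix_step (x : ℕ → Sig) (c : M.Config) : c.output <+: (M.step x c).output := by
  unfold step
  split
  · exact List.prefix_rfl
  · exact List.prefix_append _ _

theorem inPos_mono (x : ℕ → Sig) : Monotone fun n => (M.configAt x n).inPos :=
  monotone_nat_of_le_succ fun n => by
    rw [configAt_succ]
    rcases M.inPos_step x (M.configAt x n) with h | h <;> omega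

theorem output_prefix_of_le (x : ℕ → Sig) {m n : ℕ} (h : m ≤ n) :
    (M.configAt x m).output <+: (M.configAt x n).output := by
  induction n, h using Nat.le_induction with
  | base => exact List.prefix_rfl
  | succ n _ ih =>
    rw [configAt_succ]
    exact ih.trans (M.output_prefix_step _ _)

theorem exists_outputUpTo_eq (x : ℕ → Sig) (j : ℕ) :
    ∃ n, M.outputUpTo x j = (M.configAt x n).output := by
  unfold outputUpTo
  split_ifs with h
  · exact ⟨_, rfl⟩
  · exact ⟨0, rfl⟩

theorem outputUpTo_comparable (x : ℕ → Sig) {j j' : ℕ}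
    (h : (M.outputUpTo x j).length ≤ (M.outputUpTo x j').length) :
    M.outputUpTo x j <+: M.outputUpTo x j' := by
  obtain ⟨n, hn⟩ := M.exists_outputUpTo_eq x j
  obtain ⟨n', hn'⟩ := M.exists_outputUpTo_eq x j'
  rw [hn, hn'] at h ⊢
  rcases le_total n n' with hle | hle
  · exact M.output_prefix_of_le x hle
  · have := M.output_prefix_of_le x hle
    rw [this.eq_of_length (le_antisymm this.length_le h)]

theorem inputTape_congr {x x' : ℕ → Sig} {j i : ℕ} (h : ∀ k < j, x' k = x k) (hi : i ≤ j) :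
    inputTape x' i = inputTape x i := by
  cases i with
  | zero => rfl
  | succ i => simp only [inputTape]; rw [h i (by omega)]

theorem configAt_congr {x x' : ℕ → Sig} {j : ℕ} (h : ∀ k < j, x' k = x k) {n : ℕ}
    (hn : ∀ m < n, (M.configAt x m).inPos ≤ j) : M.configAt x' n = M.configAt x n := by
  induction n with
  | zero => rfl
  | succ n ih =>
    rw [configAt_succ, configAt_succ, ih fun m hm => hn m (by omega)]
    unfold step
    rw [inputTape_congr h (hn n (by omega))]

theorem exists_inPos_le {x : ℕ → Sig} {j n : ℕ} (h : j ≤ (M.configAt x n).inPos) :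
    ∃ m ≤ n, (M.configAt x m).inPos = j := by
  induction n with
  | zero => exact ⟨0, le_rfl, by simpa [configAt, initConfig, eq_comm] using h⟩
  | succ n ih =>
    by_cases hn : j ≤ (M.configAt x n).inPos
    · obtain ⟨m, hm, hm'⟩ := ih hn
      exact ⟨m, by omega, hm'⟩
    · refine ⟨n + 1, le_rfl, ?_⟩
      rw [configAt_succ] at h ⊢
      rcases M.inPos_step x (M.configAt x n) with h' | h' <;> omega

/-- Until the head moves to cell `j + 1` it reads only cells `0, …, j`. Cell `0` is the delimiter,
so these hold just the first `j` letters. -/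
theorem outputUpTo_congr {x x' : ℕ → Sig} {j : ℕ} (h : ∀ k < j, x' k = x k) :
    M.outputUpTo x' j = M.outputUpTo x j := by
  classical
  have key : ∀ x x' : ℕ → Sig, (∀ k < j, x' k = x k) →
      ∀ hx : ∃ n, (M.configAt x n).inPos = j + 1, ∀ n ≤ Nat.find hx,
        M.configAt x' n = M.configAt x n := by
    intro x x' h hx n hn
    refine M.configAt_congr h fun m hm => ?_
    by_contra hc
    obtain ⟨m', hm', he⟩ := M.exists_inPos_le (j := j + 1) (x := x) (n := m) (by omega)
    exact Nat.find_min hx (by omega) he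
  by_cases hx : ∃ n, (M.configAt x n).inPos = j + 1
  · have hx' : ∃ n, (M.configAt x' n).inPos = j + 1 :=
      ⟨Nat.find hx, by rw [key x x' h hx _ le_rfl]; exact Nat.find_spec hx⟩
    have hfind : Nat.find hx' = Nat.find hx := by
      rw [Nat.find_eq_iff]
      refine ⟨by rw [key x x' h hx _ le_rfl]; exact Nat.find_spec hx, fun m hm => ?_⟩
      rw [key x x' h hx _ hm.le]
      exact Nat.find_min hx hm
    rw [outputUpTo, outputUpTo, dif_pos hx, dif_pos hx', hfind, key x x' h hx _ le_rfl]
  · have hx' : ¬ ∃ n, (M.configAt x' n).inPos = j + 1 := fun hx' =>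
      hx ⟨Nat.find hx', by
        rw [key x' x (fun k hk => (h k hk).symm) hx' _ le_rfl]; exact Nat.find_spec hx'⟩
    rw [outputUpTo, outputUpTo, dif_neg hx, dif_neg hx']

/-- A written letter can never be revised: outputs on one input are comparable prefixes, and some
later one contains a long enough prefix of `y`. -/
theorem Computes.getElem?_eq {M : StreamMachine Sig Gam} {f : (ℕ → Sig) →. (ℕ → Gam)}
    (hM : M.Computes f) {x : ℕ → Sig} {y : ℕ → Gam} (hy : y ∈ f x) {i j : ℕ}
    (hi : i < (M.outputUpTo x j).length) : (M.outputUpTo x j)[i]? = some (y i) := by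
  obtain ⟨j', hj'⟩ := hM x y hy (M.outputUpTo x j).length
  have hlen := hj'.length_le
  rw [length_wordPrefix] at hlen
  have h1 := M.outputUpTo_comparable x hlen
  have h2 : M.outputUpTo x j = wordPrefix y (M.outputUpTo x j).length :=
    (List.prefix_of_prefix_length_le h1 hj' (by simp)).eq_of_length (by simp)
  rw [h2]
  exact getElem?_wordPrefix _ hi

end StreamMachine

theorem IsComputableFunction.continuous {Sig Gam : Type*}
    [TopologicalSpace Sig] [DiscreteTopology Sig] [TopologicalSpace Gam] [DiscreteTopology Gam]
    {f : (ℕ → Sig) →. (ℕ → Gam)} (hf : IsComputableFunction f) : Continuous f.asSubtype := by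
  obtain ⟨M, hM⟩ := hf
  rw [continuous_asSubtype_iff]
  intro x y hy i
  obtain ⟨j, hj⟩ := hM x y hy (i + 1)
  have hlen := hj.length_le
  rw [length_wordPrefix] at hlen
  refine ⟨j, fun x' y' hy' h => ?_⟩
  have h1 := hM.getElem?_eq hy (j := j) (i := i) (by omega)
  have hc := M.outputUpTo_congr h
  have h2 := hM.getElem?_eq hy' (j := j) (i := i) (by rw [hc]; omega)
  rw [hc, h1] at h2
  exact (Option.some_inj.1 h2).symm

/-! ### A machine that predicts the next letter -/

namespace PathSystem

variable {Sig Gam S : Type*} (N : PathSystem Sig Gam S)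

/-- The vertices reached with weight `j` after the tape symbol `a`, when those reached with weight
`j'` before are `Z j'`. -/
def layerStep (a : Option Sig) (Z : ℕ → Set S) (j : ℕ) : Set S :=
  {s' | (a = none ∧ j = 0 ∧ N.sym s' = none) ∨
    ∃ s j', s ∈ Z j' ∧ N.edge s s' ∧ N.sym s' = a ∧ j' + N.weight s = j}

/-- The vertices reached with weight `j` after the first `k` cells of the tape of `x`. -/
def layer (x : ℕ → Sig) : ℕ → ℕ → Set S
  | 0 => fun _ => ∅
  | k + 1 => N.layerStep (inputTape x k) (layer x k)

theorem mem_layer_succ (x : ℕ → Sig) (k : ℕ) (s : S) (j : ℕ) :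
    s ∈ N.layer x (k + 1) j ↔ (s, j) ∈ N.reach (wordPrefix x k) := by
  induction k generalizing s j with
  | zero => simp [layer, layerStep, inputTape, wordPrefix, reach, and_comm]
  | succ k ih =>
    rw [wordPrefix_succ, reach_append, layer]
    simp only [layerStep, inputTape, reduceCtorEq, false_and, false_or, ih, reachStep,
      Set.mem_ofPred_eq, eq_comm (a := j)]

/-! ### Updating the reached vertices in one left-to-right pass -/

/-- Vertices that are still to be added to the current cell (offset `0`) or to one of the next `W`
cells, at the beginning of an update. -/
def carryInit (W : ℕ) (a : Option Sig) : Set (Fin (W + 1) × S) :=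
  {p | a = none ∧ (p.1 : ℕ) = 0 ∧ N.sym p.2 = none}

/-- What is still to be added after a cell with content `z`. -/
def carryNext {W : ℕ} (a : Option Sig) (m : Set (Fin (W + 1) × S)) (z : Set S) :
    Set (Fin (W + 1) × S) :=
  {p | ∃ k : Fin (W + 1), (k : ℕ) = p.1 + 1 ∧
    ((k, p.2) ∈ m ∨ ∃ s ∈ z, N.edge s p.2 ∧ N.sym p.2 = a ∧ N.weight s = k)}

/-- The new content of a cell with content `z`. -/
def carryOut {W : ℕ} (a : Option Sig) (m : Set (Fin (W + 1) × S)) (z : Set S) : Set S :=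
  {s' | (0, s') ∈ m ∨ ∃ s ∈ z, N.edge s s' ∧ N.sym s' = a ∧ N.weight s = 0}

/-- What is carried at cell `j`. -/
def carry (W : ℕ) (a : Option Sig) (Z : ℕ → Set S) (j : ℕ) : Set (Fin (W + 1) × S) :=
  {p | (a = none ∧ j + (p.1 : ℕ) = 0 ∧ N.sym p.2 = none) ∨
    ∃ s j', j' < j ∧ s ∈ Z j' ∧ N.edge s p.2 ∧ N.sym p.2 = a ∧ j' + N.weight s = j + p.1}

theorem carry_zero (W : ℕ) (a : Option Sig) (Z : ℕ → Set S) :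
    N.carry W a Z 0 = N.carryInit W a := by
  ext p
  simp [carry, carryInit]

theorem carryOut_carry (W : ℕ) (a : Option Sig) (Z : ℕ → Set S) (j : ℕ) :
    N.carryOut a (N.carry W a Z j) (Z j) = {s' | (a = none ∧ j = 0 ∧ N.sym s' = none) ∨
      ∃ s j', j' ≤ j ∧ s ∈ Z j' ∧ N.edge s s' ∧ N.sym s' = a ∧ j' + N.weight s = j} := by
  ext s'
  simp only [carryOut, carry, Set.mem_ofPred_eq, Fin.val_zero, add_zero]
  constructor
  · rintro ((h | ⟨s, j', h1, h2⟩) | ⟨s, h1, h2, h3, h4⟩)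
    · exact Or.inl h
    · exact Or.inr ⟨s, j', h1.le, h2⟩
    · exact Or.inr ⟨s, j, le_rfl, h1, h2, h3, by omega⟩
  · rintro (h | ⟨s, j', h1, h2, h3, h4, h5⟩)
    · exact Or.inl (Or.inl h)
    · rcases h1.eq_or_lt with rfl | h1
      · exact Or.inr ⟨s, h2, h3, h4, by omega⟩
      · exact Or.inl (Or.inr ⟨s, j', h1, h2, h3, h4, h5⟩)

theorem carryOut_carry_eq_layerStep (W : ℕ) (a : Option Sig) (Z : ℕ → Set S) (j : ℕ) :
    N.carryOut a (N.carry W a Z j) (Z j) = N.layerStep a Z j := by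
  rw [carryOut_carry]
  ext s'
  simp only [layerStep, Set.mem_ofPred_eq]
  refine or_congr_right (exists_congr fun s => exists_congr fun j' => ?_)
  constructor
  · exact fun h => h.2
  · exact fun h => ⟨by have := h.2.2.2; omega, h⟩

/-- A vertex in cell `j'` contributes to cell `j' + weight`, at most `W` cells further. A buffer of
bounded size in the control state therefore suffices, although the tape is overwritten in place. -/
theorem carryNext_carry {W : ℕ} (hW : ∀ s, N.weight s ≤ W) (a : Option Sig) (Z : ℕ → Set S)
    (j : ℕ) : N.carryNext a (N.carry W a Z j) (Z j) = N.carry W a Z (j + 1) := by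
  ext p
  simp only [carryNext, carry, Set.mem_ofPred_eq]
  constructor
  · rintro ⟨k, hk, (⟨_, h, _⟩ | ⟨s, j', h1, h2, h3, h4, h5⟩) | ⟨s, h1, h2, h3, h4⟩⟩
    · omega
    · exact Or.inr ⟨s, j', by omega, h2, h3, h4, by omega⟩
    · exact Or.inr ⟨s, j, by omega, h1, h2, h3, by omega⟩
  · rintro (⟨_, h, _⟩ | ⟨s, j', h1, h2, h3, h4, h5⟩)
    · omega
    · have := hW s
      refine ⟨⟨p.1 + 1, by omega⟩, rfl, ?_⟩
      by_cases hj : j' = j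
      · subst hj
        exact Or.inr ⟨s, h2, h3, h4, by simp; omega⟩
      · exact Or.inl (Or.inr ⟨s, j', by omega, h2, h3, h4, by simp; omega⟩)

theorem exists_carry_eq_empty {W : ℕ} (a : Option Sig) {Z : ℕ → Set S}
    {n : ℕ} (hZ : ∀ j, n ≤ j → Z j = ∅) (hW : ∀ s, N.weight s ≤ W) :
    ∃ j, n ≤ j ∧ N.carry W a Z j = ∅ := by
  -- Contributions from cells below `n` stay below `n + W`; the extra `1` keeps clear of cell `0`,
  -- where initial vertices are inserted.
  refine ⟨n + W + 1, by omega, Set.eq_empty_of_forall_notMem ?_⟩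
  rintro p (⟨_, h, _⟩ | ⟨s, j', h1, h2, h3, h4, h5⟩)
  · omega
  · have := hW s
    rw [hZ j' (by omega)] at h2
    exact h2

theorem layerStep_eq_empty {W : ℕ} (hW : ∀ s, N.weight s ≤ W) {a : Option Sig} {Z : ℕ → Set S}
    {n m : ℕ} (hZ : ∀ j, n ≤ j → Z j = ∅) (hnm : n ≤ m) (hm : N.carry W a Z m = ∅) {j : ℕ}
    (hj : m ≤ j) : N.layerStep a Z j = ∅ := by
  refine Set.eq_empty_of_forall_notMem ?_
  rintro s' (⟨h1, h2, h3⟩ | ⟨s, j', h2, h3, h4, h5⟩)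
  · have : ((0 : Fin (W + 1)), s') ∈ N.carry W a Z m := Or.inl ⟨h1, by simp; omega, h3⟩
    rw [hm] at this
    exact this
  · have hj' : j' < n := by
      by_contra hc
      rw [hZ j' (by omega)] at h2
      exact h2
    have := hW s
    have : ((⟨j - m, by omega⟩ : Fin (W + 1)), s') ∈ N.carry W a Z m :=
      Or.inr ⟨s, j', by omega, h2, h3, h4, by simp; omega⟩
    rw [hm] at this
    exact this

open Classical in
/-- The common letter of the vertices in `C`, if there is exactly one. -/
noncomputable def commonLetter (C : Set S) : Option Gam :=
  if h : ∃ c, N.letter '' C = {c} then some h.choose else none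

theorem commonLetter_eq_some_iff {C : Set S} {c : Gam} :
    N.commonLetter C = some c ↔ N.letter '' C = {c} := by
  unfold commonLetter
  split_ifs with h
  · rw [Option.some_inj]
    constructor
    · rintro rfl
      exact h.choose_spec
    · intro hc
      exact Set.singleton_eq_singleton_iff.1 (h.choose_spec.symm.trans hc)
  · constructor
    · intro h'
      cases h'
    · intro hc
      exact absurd ⟨c, hc⟩ h

end PathSystem

/-- The control states of the predicting machine. -/
inductive PredictorMode (S X : Type) (W : ℕ)
  | start (adv : Bool)
  | up (adv : Bool) (m : Set (Fin (W + 1) × S))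
  | back (adv : Bool)
  | seek (adv : Bool)
  | scan (x : X) (C : Set S)

instance {S X : Type} {W : ℕ} [Finite S] [Finite X] : Finite (PredictorMode S X W) := by
  let g : Bool ⊕ (Bool × Set (Fin (W + 1) × S)) ⊕ Bool ⊕ Bool ⊕ (X × Set S) →
      PredictorMode S X W :=
    Sum.elim .start (Sum.elim (fun p => .up p.1 p.2) (Sum.elim .back (Sum.elim .seek
      fun p => .scan p.1 p.2)))
  refine Finite.of_surjective g ?_
  rintro (adv | ⟨adv, m⟩ | adv | adv | ⟨x, C⟩)
  · exact ⟨.inl adv, rfl⟩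
  · exact ⟨.inr (.inl (adv, m)), rfl⟩
  · exact ⟨.inr (.inr (.inl adv)), rfl⟩
  · exact ⟨.inr (.inr (.inr (.inl adv))), rfl⟩
  · exact ⟨.inr (.inr (.inr (.inr (x, C)))), rfl⟩

section Predictor

variable {Sig Gam : Type*} {S X : Type} (N : PathSystem Sig Gam S) (W : ℕ)
  (x₀ : X) (G : X → X) (A : X → Set S)

open Classical in
/-- The transitions of the predicting machine. On its work tape, cell `j` holds the vertices
reached with weight `j`, and whether `j` is less than the length of the output so far. For each
input symbol, the first track is updated (`up`), then the first cell beyond the length of the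
output is looked for (`seek`, which also accounts for a letter just output if `adv` holds), and on
the way back (`scan`) the vertices that determine the possible next letters are collected. -/
noncomputable def predictorTrans :
    PredictorMode S X W → Option Sig → Option (Option (Set S) × Bool) →
      Option (MachineAction (PredictorMode S X W) (Option (Set S) × Bool) Gam)
  | .start adv, a, none =>
    some ⟨.up adv (N.carryInit W a), (none, false), .right, false, none⟩
  | .up adv m, a, some (z, b) =>
    if z = none ∧ m = ∅ then some ⟨.back adv, (z, b), .left, false, none⟩
    else some ⟨.up adv (N.carryNext a m (z.getD ∅)), (some (N.carryOut a m (z.getD ∅)), b),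
      .right, false, none⟩
  | .back adv, _, some z => some ⟨.back adv, z, .left, false, none⟩
  | .back adv, _, none => some ⟨.seek adv, (none, false), .right, false, none⟩
  | .seek adv, _, some (z, true) => some ⟨.seek adv, (z, true), .right, false, none⟩
  | .seek true, _, some (z, false) => some ⟨.seek false, (z, true), .right, false, none⟩
  | .seek false, _, some (z, false) => some ⟨.scan x₀ ∅, (z, false), .stay, false, none⟩
  | .scan x C, _, some (z, b) =>
    some ⟨.scan (G x) (C ∪ z.getD ∅ ∩ A x), (z, b), .left, false, none⟩
  | .scan _ C, _, none =>
    some ⟨.start (N.commonLetter C).isSome, (none, false), .stay, true, N.commonLetter C⟩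
  | _, _, _ => none

/-- The predicting machine. -/
noncomputable def predictor [Finite S] [Finite X] : StreamMachine Sig Gam where
  State := PredictorMode S X W
  Work := Option (Set S) × Bool
  finState := inferInstance
  finWork := inferInstance
  blank := (none, false)
  init := .start false
  trans := predictorTrans N W x₀ G A

variable [Finite S] [Finite X]

/-- A configuration of the predicting machine with the two tracks `t` and `b`. -/
noncomputable def predictorConfig (q : PredictorMode S X W) (k : ℕ) (t : ℕ → Option (Set S))
    (b : ℕ → Bool) (p : ℕ) (v : List Gam) : (predictor N W x₀ G A).Config :=
  ⟨q, k, fun i => (t i, b i), p, v⟩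

theorem update_pair {α β : Type*} (t : ℕ → α) (b : ℕ → β) (j : ℕ) (z : α) (c : β) :
    Function.update (fun i => (t i, b i)) j (z, c) =
      fun i => (Function.update t j z i, Function.update b j c i) := by
  ext i <;> by_cases h : i = j <;> simp [Function.update, h]

variable {N W x₀ G A} {w : ℕ → Sig} {k : ℕ} {t : ℕ → Option (Set S)} {b : ℕ → Bool} {j : ℕ}
  {v : List Gam} {adv : Bool} {m : Set (Fin (W + 1) × S)} {x : X} {C : Set S}

local notation "conf" => predictorConfig N W x₀ G A
local notation "nextConf" => StreamMachine.step (predictor N W x₀ G A)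

theorem step_start : nextConf w (conf (.start adv) k t b 0 v) =
    conf (.up adv (N.carryInit W (inputTape w k))) k t b 1 v := by
  simp [StreamMachine.step, predictor, predictorConfig, predictorTrans, StreamMachine.readWork,
    StreamMachine.writeWork, StreamMachine.movedPos]

theorem step_up_halt (ht : t j = none) : nextConf w (conf (.up adv ∅) k t b (j + 1) v) =
    conf (.back adv) k t b j v := by
  simp [StreamMachine.step, predictor, predictorConfig, predictorTrans, StreamMachine.readWork,
    StreamMachine.writeWork, StreamMachine.movedPos, ht, update_pair]
  simp [← ht]

theorem step_up (h : ¬ (t j = none ∧ m = ∅)) : nextConf w (conf (.up adv m) k t b (j + 1) v) =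
    conf (.up adv (N.carryNext (inputTape w k) m ((t j).getD ∅))) k
      (Function.update t j (some (N.carryOut (inputTape w k) m ((t j).getD ∅)))) b (j + 2) v := by
  simp [StreamMachine.step, predictor, predictorConfig, predictorTrans, StreamMachine.readWork,
    StreamMachine.writeWork, StreamMachine.movedPos, h, update_pair]

theorem step_back : nextConf w (conf (.back adv) k t b (j + 1) v) = conf (.back adv) k t b j v := by
  simp [StreamMachine.step, predictor, predictorConfig, predictorTrans, StreamMachine.readWork,
    StreamMachine.writeWork, StreamMachine.movedPos]

theorem step_back_zero : nextConf w (conf (.back adv) k t b 0 v) = conf (.seek adv) k t b 1 v := by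
  simp [StreamMachine.step, predictor, predictorConfig, predictorTrans, StreamMachine.readWork,
    StreamMachine.writeWork, StreamMachine.movedPos]

theorem step_seek (h : b j = true) : nextConf w (conf (.seek adv) k t b (j + 1) v) =
    conf (.seek adv) k t b (j + 2) v := by
  simp [StreamMachine.step, predictor, predictorConfig, predictorTrans, StreamMachine.readWork,
    StreamMachine.writeWork, StreamMachine.movedPos, h, update_pair]
  simp [← h]

theorem step_seek_advance (h : b j = false) : nextConf w (conf (.seek true) k t b (j + 1) v) =
    conf (.seek false) k t (Function.update b j true) (j + 2) v := by
  simp [StreamMachine.step, predictor, predictorConfig, predictorTrans, StreamMachine.readWork,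
    StreamMachine.writeWork, StreamMachine.movedPos, h, update_pair]

theorem step_seek_done (h : b j = false) : nextConf w (conf (.seek false) k t b (j + 1) v) =
    conf (.scan x₀ ∅) k t b (j + 1) v := by
  simp [StreamMachine.step, predictor, predictorConfig, predictorTrans, StreamMachine.readWork,
    StreamMachine.writeWork, StreamMachine.movedPos, h, update_pair]
  simp [← h]

theorem step_scan : nextConf w (conf (.scan x C) k t b (j + 1) v) =
    conf (.scan (G x) (C ∪ (t j).getD ∅ ∩ A x)) k t b j v := by
  simp [StreamMachine.step, predictor, predictorConfig, predictorTrans, StreamMachine.readWork,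
    StreamMachine.writeWork, StreamMachine.movedPos]

theorem step_scan_zero : nextConf w (conf (.scan x C) k t b 0 v) =
    conf (.start (N.commonLetter C).isSome) (k + 1) t b 0 (v ++ (N.commonLetter C).toList) := by
  simp [StreamMachine.step, predictor, predictorConfig, predictorTrans, StreamMachine.readWork,
    StreamMachine.writeWork, StreamMachine.movedPos]

end Predictor

/-! ### One round of the predicting machine per input cell -/

/-- `c'` is reached from `c` on input `x`. -/
def StreamMachine.Reaches {Sig Gam : Type*} (M : StreamMachine Sig Gam) (x : ℕ → Sig)
    (c c' : M.Config) : Prop :=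
  ∃ n, (M.step x)^[n] c = c'

namespace StreamMachine.Reaches

variable {Sig Gam : Type*} {M : StreamMachine Sig Gam} {x : ℕ → Sig} {c c' c'' : M.Config}

theorem refl : M.Reaches x c c := ⟨0, rfl⟩

theorem trans (h : M.Reaches x c c') (h' : M.Reaches x c' c'') : M.Reaches x c c'' := by
  obtain ⟨n, rfl⟩ := h
  obtain ⟨n', rfl⟩ := h'
  exact ⟨n' + n, Function.iterate_add_apply _ _ _ _⟩

theorem step (h : M.step x c = c') : M.Reaches x c c' := ⟨1, h⟩

end StreamMachine.Reaches

/-- The track that holds `Z` on its first `n` cells. -/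
def track {S : Type*} (n : ℕ) (Z : ℕ → Set S) (j : ℕ) : Option (Set S) :=
  if j < n then some (Z j) else none

theorem track_getD {S : Type*} {n : ℕ} {Z : ℕ → Set S} (hZ : ∀ j, n ≤ j → Z j = ∅) (j : ℕ) :
    (track n Z j).getD ∅ = Z j := by
  unfold track
  split_ifs with h
  · rfl
  · rw [hZ j (by omega)]; rfl

section Predictor

variable {Sig Gam : Type*} {S X : Type} {N : PathSystem Sig Gam S} {W : ℕ}
  {x₀ : X} {G : X → X} {A : X → Set S} [Finite S] [Finite X]
  {w : ℕ → Sig} {k : ℕ} {t : ℕ → Option (Set S)} {b : ℕ → Bool} {j : ℕ}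
  {v : List Gam} {adv : Bool} {m : Set (Fin (W + 1) × S)} {x : X} {C : Set S}

local notation "conf" => predictorConfig N W x₀ G A
local notation "goesTo" => StreamMachine.Reaches (predictor N W x₀ G A) w

open StreamMachine

theorem reaches_back : goesTo (conf (.back adv) k t b j v) (conf (.back adv) k t b 0 v) := by
  induction j with
  | zero => exact .refl
  | succ j ih => exact (Reaches.step step_back).trans ih

theorem reaches_up (hW : ∀ s, N.weight s ≤ W) {n : ℕ} {Z : ℕ → Set S}
    (hZ : ∀ j, n ≤ j → Z j = ∅) :
    ∃ n', (∀ j, n' ≤ j → N.layerStep (inputTape w k) Z j = ∅) ∧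
      goesTo (conf (.start adv) k (track n Z) b 0 v)
        (conf (.seek adv) k (track n' (N.layerStep (inputTape w k) Z)) b 1 v) := by
  classical
  -- The upward pass halts at the first cell past the old content at which nothing is carried, and
  -- this cell becomes the new end of the track.
  have hex := N.exists_carry_eq_empty (inputTape w k) hZ hW
  obtain ⟨hn, hc⟩ := Nat.find_spec hex
  set n' := Nat.find hex with hn'
  refine ⟨n', fun j hj => N.layerStep_eq_empty hW hZ hn hc hj, ?_⟩
  have hup : ∀ j ≤ n', goesTo (conf (.start adv) k (track n Z) b 0 v)
      (conf (.up adv (N.carry W (inputTape w k) Z j)) k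
        (fun i => if i < j then some (N.layerStep (inputTape w k) Z i) else track n Z i) b
          (j + 1) v) := by
    intro j
    induction j with
    | zero =>
      intro _
      refine Reaches.step ?_
      rw [step_start, N.carry_zero]
      simp
    | succ j ih =>
      intro hj
      refine (ih (by omega)).trans (Reaches.step ?_)
      have hget : ((fun i => if i < j then some (N.layerStep (inputTape w k) Z i)
          else track n Z i) j).getD ∅ = Z j := by
        simp [track_getD hZ]
      rw [step_up, hget, N.carryNext_carry hW, N.carryOut_carry_eq_layerStep]
      · congr 1
        funext i
        simp only [Function.update_apply]
        by_cases h1 : i = j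
        · simp [h1]
        · by_cases h2 : i < j
          · simp [h1, h2, Nat.lt_succ_of_lt h2]
          · simp [h1, h2, show ¬ i < j + 1 by omega]
      · rintro ⟨h1, h2⟩
        simp only [lt_irrefl, if_false, track] at h1
        refine Nat.find_min hex (m := j) (by omega) ⟨?_, h2⟩
        by_contra h3
        rw [if_pos (by omega)] at h1
        cases h1
  have hlast := hup n' le_rfl
  rw [hc] at hlast
  have htr : (fun i => if i < n' then some (N.layerStep (inputTape w k) Z i) else track n Z i) =
      track n' (N.layerStep (inputTape w k) Z) := by
    funext i
    unfold track
    by_cases h : i < n'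
    · simp [h]
    · simp [h, show ¬ i < n by omega]
  rw [htr] at hlast
  refine hlast.trans ((Reaches.step (step_up_halt ?_)).trans
    (reaches_back.trans (Reaches.step step_back_zero)))
  simp [track]

theorem reaches_seek_add {l : ℕ} (hb : ∀ i < l, b (j + i) = true) :
    goesTo (conf (.seek adv) k t b (j + 1) v) (conf (.seek adv) k t b (j + l + 1) v) := by
  induction l with
  | zero => exact .refl
  | succ l ih =>
    exact (ih fun i hi => hb i (by omega)).trans (Reaches.step (step_seek (hb l (by omega))))

/-- The marks lag behind the output: a letter emitted at the end of one round is marked in the next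
one. The search ends on the cell whose index is the length of the output. -/
theorem reaches_seek (l : ℕ) :
    goesTo (conf (.seek adv) k t (fun i => decide (i < l)) 1 v)
      (conf (.scan x₀ ∅) k t (fun i => decide (i < l + adv.toNat)) (l + adv.toNat + 1) v) := by
  have h1 := reaches_seek_add (N := N) (W := W) (x₀ := x₀) (G := G) (A := A) (w := w) (k := k)
    (t := t) (v := v) (adv := adv) (j := 0) (l := l) (b := fun i => decide (i < l))
    (fun i hi => by simpa using hi)
  simp only [zero_add] at h1
  refine h1.trans ?_
  cases adv with
  | false => exact Reaches.step (step_seek_done (by simp))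
  | true =>
    refine (Reaches.step (step_seek_advance (by simp))).trans (Reaches.step ?_)
    have hb : Function.update (fun i => decide (i < l)) l true = fun i => decide (i < l + 1) := by
      funext i
      by_cases h : i = l
      · simp [h]
      · rw [Function.update_of_ne h]
        exact decide_eq_decide.2 (by omega)
    rw [hb]
    exact step_seek_done (by simp)

/-- Walking back from cell `i`, the unary automaton advances once per cell. At cell `j` it has read
`i - j`, the weight that vertices collected with weight `j` still need. -/
theorem reaches_scan {Z : ℕ → Set S} (ht : ∀ j, (t j).getD ∅ = Z j) (i : ℕ) :
    ∃ x, goesTo (conf (.scan x₀ ∅) k t b (i + 1) v)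
      (conf (.scan x {s | ∃ j d, s ∈ Z j ∧ s ∈ A (G^[d] x₀) ∧ j + d = i}) k t b 0 v) := by
  have key : ∀ l ≤ i + 1, goesTo (conf (.scan x₀ ∅) k t b (i + 1) v)
      (conf (.scan (G^[l] x₀) {s | ∃ j d, d < l ∧ s ∈ Z j ∧ s ∈ A (G^[d] x₀) ∧ j + d = i}) k t b
        (i + 1 - l) v) := by
    intro l
    induction l with
    | zero =>
      intro _
      simpa using Reaches.refl
    | succ l ih =>
      intro hl
      refine (ih (by omega)).trans (Reaches.step ?_)
      rw [show i + 1 - l = i - l + 1 by omega, step_scan, ← Function.iterate_succ_apply' G, ht,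
        show i + 1 - (l + 1) = i - l by omega]
      congr 2
      ext s
      simp only [Set.mem_union, Set.mem_ofPred_eq, Set.mem_inter_iff]
      constructor
      · rintro (⟨j, d, h1, h2⟩ | ⟨h1, h2⟩)
        · exact ⟨j, d, by omega, h2⟩
        · exact ⟨i - l, l, by omega, h1, h2, by omega⟩
      · rintro ⟨j, d, h1, h2, h3, h4⟩
        by_cases hd : d = l
        · subst hd
          obtain rfl : j = i - d := by omega
          exact Or.inr ⟨h2, h3⟩
        · exact Or.inl ⟨j, d, by omega, h2, h3, h4⟩
  have h := key (i + 1) le_rfl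
  refine ⟨G^[i + 1] x₀, ?_⟩
  have hC : {s | ∃ j d, d < i + 1 ∧ s ∈ Z j ∧ s ∈ A (G^[d] x₀) ∧ j + d = i} =
      {s | ∃ j d, s ∈ Z j ∧ s ∈ A (G^[d] x₀) ∧ j + d = i} := by
    ext s
    constructor
    · rintro ⟨j, d, _, h⟩
      exact ⟨j, d, h⟩
    · rintro ⟨j, d, h⟩
      exact ⟨j, d, by omega, h⟩
  rwa [hC, Nat.sub_self] at h

/-- The letter that is output after the first `k` cells of the tape of `w` and the output `v`. -/
noncomputable def nextLetter (N : PathSystem Sig Gam S) (w : ℕ → Sig) (k : ℕ) (v : List Gam) :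
    Option Gam :=
  N.commonLetter {s | ∃ j d, s ∈ N.layer w (k + 1) j ∧ N.Total s d ∧ j + d = v.length}

/-- The output of the predicting machine when it arrives at cell `k`. -/
noncomputable def predicted (N : PathSystem Sig Gam S) (w : ℕ → Sig) : ℕ → List Gam
  | 0 => []
  | k + 1 => predicted N w k ++ (nextLetter N w k (predicted N w k)).toList

/-- This is the invariant at the start of each round. The last clause says that the head arrives at
cell `k` in exactly this step, which identifies the minimal time in `outputUpTo`. -/
theorem exists_configAt (hW : ∀ s, N.weight s ≤ W)
    (hA : ∀ n s, s ∈ A (G^[n] x₀) ↔ N.Total s n) (w : ℕ → Sig) (k : ℕ) :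
    ∃ n adv l τ, ((predictor N W x₀ G A).configAt w n = conf (.start adv) k
        (track l (N.layer w k)) (fun i => decide (i < τ)) 0 (predicted N w k)) ∧
      (∀ j, l ≤ j → N.layer w k j = ∅) ∧ τ + adv.toNat = (predicted N w k).length ∧
      ∀ k', k = k' + 1 →
        ∃ n', n = n' + 1 ∧ ((predictor N W x₀ G A).configAt w n').inPos = k' := by
  induction k with
  | zero =>
    refine ⟨0, false, 0, 0, ?_, fun _ _ => rfl, rfl, fun k' hk' => by omega⟩
    simp [configAt, initConfig, predictorConfig, predictor, track, predicted]
  | succ k ih =>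
    obtain ⟨n, adv, l, τ, h1, h2, h3, -⟩ := ih
    obtain ⟨l', h4, h5⟩ := reaches_up (N := N) (W := W) (x₀ := x₀) (G := G) (A := A) (w := w)
      (k := k) (b := fun i => decide (i < τ)) (v := predicted N w k) (adv := adv) hW h2
    have h6 := reaches_seek (N := N) (W := W) (x₀ := x₀) (G := G) (A := A) (w := w)
      (k := k) (t := track l' (N.layerStep (inputTape w k) (N.layer w k)))
      (v := predicted N w k) (adv := adv) τ
    obtain ⟨x, h7⟩ := reaches_scan (N := N) (W := W) (x₀ := x₀) (G := G) (A := A) (w := w)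
      (k := k) (b := fun i => decide (i < τ + adv.toNat)) (v := predicted N w k)
      (track_getD h4) (τ + adv.toNat)
    obtain ⟨n', hn'⟩ := (h5.trans h6).trans h7
    have h8 := Function.iterate_add_apply ((predictor N W x₀ G A).step w) n' n (initConfig _)
    change (predictor N W x₀ G A).configAt w (n' + n) =
      (step _ w)^[n'] ((predictor N W x₀ G A).configAt w n) at h8
    rw [h1, hn', h3] at h8
    simp only [hA] at h8
    refine ⟨n' + n + 1, (nextLetter N w k (predicted N w k)).isSome, l', (predicted N w k).length,
      ?_, h4, ?_, fun k' hk' => ⟨n' + n, rfl, ?_⟩⟩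
    · rw [configAt_succ, h8, step_scan_zero]
      rfl
    · rw [predicted, List.length_append]
      cases nextLetter N w k (predicted N w k) <;> rfl
    · rw [h8]
      simp only [predictorConfig]
      omega

/-- The index shifts by one because the letter decided at cell `k` is emitted in the very step that
leaves cell `k`. -/
theorem outputUpTo_predictor (hW : ∀ s, N.weight s ≤ W)
    (hA : ∀ n s, s ∈ A (G^[n] x₀) ↔ N.Total s n) (w : ℕ → Sig) (k : ℕ) :
    (predictor N W x₀ G A).outputUpTo w k = predicted N w (k + 1) := by
  classical
  obtain ⟨n, adv, l, τ, h1, -, -, h4⟩ := exists_configAt (N := N) (W := W) hW hA w (k + 1)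
  obtain ⟨n', rfl, h5⟩ := h4 k rfl
  have hex : ∃ n, ((predictor N W x₀ G A).configAt w n).inPos = k + 1 := ⟨n' + 1, by rw [h1]; rfl⟩
  have hfind : Nat.find hex = n' + 1 := by
    rw [Nat.find_eq_iff]
    refine ⟨by rw [h1]; rfl, fun m hm hm' => ?_⟩
    have := (predictor N W x₀ G A).inPos_mono w (show m ≤ n' by omega)
    simp only at this
    omega
  rw [outputUpTo, dif_pos hex, hfind, h1]
  rfl

end Predictor

/-! ### Correctness and progress of the prediction -/

namespace PathSystem

variable {Sig Gam : Type*} {S : Type} {N : PathSystem Sig Gam S} {f : (ℕ → Sig) →. (ℕ → Gam)}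

theorem Describes.nextLetter_eq_some_iff (hf : N.Describes f) {w : ℕ → Sig} {k : ℕ} {v : List Gam}
    {c : Gam} : nextLetter N w k v = some c ↔
      {c' | ∃ x, ∃ y ∈ f x, wordPrefix w k = wordPrefix x k ∧ y v.length = c'} = {c} := by
  have h : N.letter '' {s | ∃ j d, s ∈ N.layer w (k + 1) j ∧ N.Total s d ∧ j + d = v.length} =
      {c' | ∃ x, ∃ y ∈ f x, wordPrefix w k = wordPrefix x k ∧ y v.length = c'} := by
    ext c'
    have := hf.possible_iff (u := wordPrefix w k) (i := v.length) (c := c')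
    rw [length_wordPrefix] at this
    simp only [Set.mem_ofPred_eq]
    rw [← this]
    constructor
    · rintro ⟨s, ⟨j, d, h1, h2, h3⟩, rfl⟩
      exact ⟨s, j, (N.mem_layer_succ w k s j).1 h1, rfl, d, h2, h3⟩
    · rintro ⟨s, j, h1, rfl, d, h2, h3⟩
      exact ⟨s, ⟨j, d, (N.mem_layer_succ w k s j).2 h1, h2, h3⟩, rfl⟩
  rw [nextLetter, commonLetter_eq_some_iff, h]

/-- Correctness needs no continuity: the true next letter is always among the possible ones, so a
unique possible letter is the true one. -/
theorem Describes.predicted_eq (hf : N.Describes f) {x : ℕ → Sig} {y : ℕ → Gam} (hy : y ∈ f x)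
    (k : ℕ) : predicted N x k = wordPrefix y (predicted N x k).length := by
  induction k with
  | zero => rfl
  | succ k ih =>
    rw [predicted]
    cases h : nextLetter N x k (predicted N x k) with
    | none => simpa using ih
    | some c =>
      have hc := hf.nextLetter_eq_some_iff.1 h
      have hmem : y (predicted N x k).length ∈ ({c} : Set Gam) := by
        rw [← hc]
        exact ⟨x, y, hy, rfl, rfl⟩
      have hyc : y (predicted N x k).length = c := hmem
      simp only [Option.toList_some, List.length_append, List.length_singleton]
      rw [wordPrefix_succ, ← ih, hyc]

theorem Describes.exists_le_length_predicted (hf : N.Describes f) {x : ℕ → Sig} {y : ℕ → Gam}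
    (hy : y ∈ f x)
    (hc : ∀ i, ∃ k, ∀ x', ∀ y' ∈ f x', (∀ j < k, x' j = x j) → y' i = y i) (i : ℕ) :
    ∃ k, i ≤ (predicted N x k).length := by
  induction i with
  | zero => exact ⟨0, Nat.zero_le _⟩
  | succ i ih =>
    obtain ⟨k, hk⟩ := ih
    by_contra hlt
    push Not at hlt
    have hmono : Monotone fun k => (predicted N x k).length :=
      monotone_nat_of_le_succ fun k => by rw [predicted, List.length_append]; omega
    obtain ⟨k', hk'⟩ := hc i
    have h1 := hmono (le_max_left k k')
    have h2 := hlt (max k k')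
    simp only at h1
    -- If the output were stuck at length `i`, then past the modulus of continuity `k'` for position
    -- `i` only `y i` would be possible, and the next round would output it.
    have hlen : (predicted N x (max k k')).length = i := by omega
    have hnext : nextLetter N x (max k k') (predicted N x (max k k')) = some (y i) := by
      rw [hf.nextLetter_eq_some_iff, hlen]
      ext c'
      simp only [Set.mem_ofPred_eq, Set.mem_singleton_iff]
      constructor
      · rintro ⟨x', y', hy', hp, rfl⟩
        refine hk' x' y' hy' fun j hj => ?_
        have h3 := getElem?_wordPrefix x (show j < max k k' from hj.trans_le (le_max_right _ _))
        have h4 := getElem?_wordPrefix x' (show j < max k k' from hj.trans_le (le_max_right _ _))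
        rw [hp, h4] at h3
        exact Option.some_inj.1 h3
      · rintro rfl
        exact ⟨x, y, hy, rfl, rfl⟩
    have h3 := hlt (max k k' + 1)
    rw [predicted, hnext, List.length_append] at h3
    simp only [Option.toList_some, List.length_singleton] at h3
    omega

theorem Describes.isComputableFunction [Finite S] (hf : N.Describes f)
    (hc : ∀ x, ∀ y ∈ f x, ∀ i, ∃ k, ∀ x', ∀ y' ∈ f x', (∀ j < k, x' j = x j) → y' i = y i) :
    IsComputableFunction f := by
  obtain ⟨k, x₀, G, A, hA⟩ := N.exists_unary_automaton
  obtain ⟨W, hW⟩ := (Set.finite_range N.weight).bddAbove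
  have hW : ∀ s, N.weight s ≤ W := fun s => hW ⟨s, rfl⟩
  refine ⟨predictor N W x₀ G A, fun x y hy i => ?_⟩
  obtain ⟨j, hj⟩ := hf.exists_le_length_predicted hy (hc x y hy) i
  refine ⟨j, ?_⟩
  rw [outputUpTo_predictor hW hA, predicted]
  refine List.IsPrefix.trans ?_ (List.prefix_append _ _)
  rw [hf.predicted_eq hy j]
  exact (List.prefix_iff_eq_take.2 (by simp [wordPrefix, ← List.map_take, List.take_range, hj]))

end PathSystem

theorem theorem2 {Sig Gam : Type*} [Finite Sig] [Finite Gam]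
    [TopologicalSpace Sig] [DiscreteTopology Sig] [TopologicalSpace Gam] [DiscreteTopology Gam]
    (f : (ℕ → Sig) →. (ℕ → Gam)) (hf : IsRegularFunction f) :
    (IsComputableFunction f ↔ Continuous f.asSubtype) ∧ MismatchDecidable f := by
  obtain ⟨K, N, hN⟩ := hf.exists_describes
  exact ⟨⟨fun h => h.continuous, fun h =>
    hN.isComputableFunction ((continuous_asSubtype_iff f).1 h)⟩, hN.mismatchDecidable⟩
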